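/- **Theorem (Jackson–Bernstein theorem).** Let $\mathcal A$ be a unital complex Banach algebra and let $\Psi=\{\psi_t\}_{t\in\mathbb R^d}$ be a uniformly bounded $d$-parameter automorphism group of $\mathcal A$: each $\psi_t$ is an algebra automorphism of $\mathcal A$, $\psi_s\psi_t=\psi_{s+t}$ for all $s,t$, and $\sup_{t}\|\psi_t\|_{\mathcal A\to\mathcal A}<\infty$ (no continuity of $t\mapsto\psi_t(a)$ is assumed). *Smoothness.* Let $C(\mathcal A)=\{a:\|\psi_t(a)-a\|\to0 \text{ as } t\to0\}$. Let $\delta_j(a)=\lim_{h\to0}h^{-1}(\psi_{he_j}(a)-a)$ ($1\le j\le d$), with domain the set of $a$ for which the norm limit exists, and $\delta^\alpha=\delta_1^{\alpha_1}\cdots\delta_d^{\alpha_d}$. Let $C^k(\mathcal A)$ be the set of all $a$ for which $a$ and all iterated derivatives $\delta_{j_1}\cdots\delta_{j_n}a$, $n\le k$, exist and lie in $C(\mathcal A)$, with norm $\|a\|_{C^k(\mathcal A)}=\sum_{|\alpha|\le k}\frac1{\alpha!}\|\delta^\alpha(a)\|$. Put $\Delta_ta=\psi_t(a)-a$, $\Delta_t^2=\Delta_t\Delta_t$,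 and, for $0<\eta\le1$, $|a|_{\Lambda_\eta}=\sup_{t\ne0}|t|^{-\eta}\|\Delta_t^2a\|$, where $|t|=\sum_j|t_j|$. For $r>0$ write $r=k+\eta$ with $k\in\mathbb N_0$, $0<\eta\le1$. The Hölder–Zygmund space $\Lambda_r(\mathcal A)$ consists of all $a\in C^k(\mathcal A)$ with $$\|a\|_{\Lambda_r(\mathcal A)}=\|a\|_{C^k(\mathcal A)}+\sum_{|\alpha|=k}|\delta^\alpha(a)|_{\Lambda_\eta}<\infty .$$ *Approximation.* For $a\in C(\mathcal A)$ let $\operatorname{spec}(a)=\bigcup_{a'\in\mathcal A'}\operatorname{supp}\mathcal F(G_{a',a})$, where $\mathcal A'$ is the dual space of $\mathcal A$, $G_{a',a}(t)=\langle a',\psi_t(a)\rangle$, and $\mathcal F$ is the Fourier transform of tempered distributions extending $\mathcal Ff(\omega)=\int_{\mathbb R^d} f(x)e^{-2\pi i\omega\cdot x}\,dx$. Let $X_0=\{0\}$ and let $X_\sigma=\{a\in C(\mathcal A):\operatorname{spec}(a)\subseteq[-\sigma,\sigma]^d\}$, $\sigma>0$, be the set of $\sigma$-bandlimited elements. Put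 $E_\sigma(a)=\inf_{x\in X_\sigma}\|a-x\|$, and let $\mathcal E^\infty_r(\mathcal A)$ be the space of all $a\in\mathcal A$ with $\|a\|_{\mathcal E^\infty_r}=\sup_{\sigma\ge0}E_\sigma(a)(\sigma+1)^r<\infty$. Then, for every $r>0$, $$\Lambda_r(\mathcal A)=\mathcal E^\infty_r(\mathcal A)$$ with equivalent norms. In other words, $a\in\Lambda_r(\mathcal A)$ if and only if there is a constant $C$ such that $E_\sigma(a)\le C\sigma^{-r}$ for all $\sigma>0$. -/

import Mathlib

open scoped ENNReal NNReal SchwartzMap FourierTransform Nat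

noncomputable section

/-- A uniformly bounded `d`-parameter group of automorphisms `ψ_t`, `t ∈ ℝ^d`, of a Banach algebra. -/
structure AutomorphismGroup (d : ℕ) (A : Type*) [NormedRing A] [NormedAlgebra ℂ A] where
  /-- the automorphism `ψ_t` -/
  psi : EuclideanSpace ℝ (Fin d) → (A ≃ₐ[ℂ] A)
  psi_add : ∀ (s t : EuclideanSpace ℝ (Fin d)) (a : A), psi (s + t) a = psi s (psi t a)
  bounded : ∃ M : ℝ, ∀ (t : EuclideanSpace ℝ (Fin d)) (a : A), ‖psi t a‖ ≤ M * ‖a‖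

namespace AutomorphismGroup

variable {d : ℕ} {A : Type*} [NormedRing A] [NormedAlgebra ℂ A] (Ψ : AutomorphismGroup d A)

/-- The set `C(A)` of continuous elements: `ψ_t(a) → a` in norm as `t → 0`. -/
def contElements : Set A :=
  {a | Filter.Tendsto (fun t : EuclideanSpace ℝ (Fin d) => ‖Ψ.psi t a - a‖) (nhds 0) (nhds 0)}

/-! ### Generators and the spaces `C^k(A)` -/

/-- The domain of the generator `δ_t`: the limit of `(ψ_{ht}(a) - a) / h` as `h → 0` exists in `A`. -/
def genDomain (t : EuclideanSpace ℝ (Fin d)) : Set A :=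
  {a | DifferentiableAt ℝ (fun h : ℝ => Ψ.psi (h • t) a) 0}

/-- The generator `δ_t` (meaningful on its domain). -/
def gen (t : EuclideanSpace ℝ (Fin d)) (a : A) : A :=
  deriv (fun h : ℝ => Ψ.psi (h • t) a) 0

/-- The domain of the canonical generator `δ_j`. -/
def canDomain (j : Fin d) : Set A := Ψ.genDomain (EuclideanSpace.single j 1)

/-- The canonical generator `δ_j`. -/
def canGen (j : Fin d) (a : A) : A := Ψ.gen (EuclideanSpace.single j 1) a

/-- The domain in `C(A)` of a finite product `δ_{j_1} ⋯ δ_{j_n}` of canonical generators, by induction: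
`D(δ_j w) = {a ∈ D(w) : a ∈ D(δ_j), δ_j a ∈ D(w)}`. -/
def wordDomain : List (Fin d) → Set A
  | [] => Ψ.contElements
  | j :: w => {a | a ∈ wordDomain w ∧ a ∈ Ψ.canDomain j ∧ Ψ.canGen j a ∈ wordDomain w}

/-- `C^k(A)`: the elements that lie in the domain, relative to `C(A)`, of every product of at most `k`
canonical generators (the product is independent of the order of its factors there). -/
def smoothElements (k : ℕ) : Set A := {a | ∀ w : List (Fin d), w.length ≤ k → a ∈ Ψ.wordDomain w}

/-- `δ^α = δ_1^{α_1} ⋯ δ_d^{α_d}` for a multi-index `α`. -/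
def multiGen (α : Fin d → ℕ) (a : A) : A :=
  ((List.finRange d).flatMap fun j => List.replicate (α j) j).foldr Ψ.canGen a

/-- `‖a‖_{C^k(A)} = ∑_{|α| ≤ k} ‖δ^α a‖ / α!`, for `a ∈ C^k(A)`. -/
def smoothNorm (k : ℕ) (a : A) : ℝ :=
  ∑ m ∈ Finset.range (k + 1), ∑ α ∈ Finset.piAntidiag (Finset.univ : Finset (Fin d)) m,
    (∏ j, ((α j)! : ℝ))⁻¹ * ‖Ψ.multiGen α a‖

/-! ### Hölder–Zygmund spaces -/

/-- The difference operator `Δ_t a = ψ_t(a) - a`. -/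
def diff (t : EuclideanSpace ℝ (Fin d)) (a : A) : A := Ψ.psi t a - a

/-- `|a|_{Λ_η} = sup_{t ≠ 0} |t|^{-η} ‖Δ_t² a‖`, where `|t|` is the 1-norm of `t`. -/
def zygmundSeminorm (η : ℝ) (a : A) : ℝ≥0∞ :=
  ⨆ (t : EuclideanSpace ℝ (Fin d)) (_ : t ≠ 0),
    ENNReal.ofReal ((∑ j, |t j|) ^ (-η) * ‖(Ψ.diff t)^[2] a‖)

open Classical in
/-- `‖a‖_{Λ_r} = ‖a‖_{C^k} + ∑_{|α| = k} |δ^α a|_{Λ_η}`, where `r = k + η`, `k ∈ ℕ₀`, `0 < η ≤ 1`,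
that is `k = ⌈r⌉ - 1` for `r > 0`; it is `∞` if `a ∉ C^k(A)`. -/
def holderNorm (r : ℝ) (a : A) : ℝ≥0∞ :=
  let k : ℕ := ⌈r⌉₊ - 1
  if a ∈ Ψ.smoothElements k then
    ENNReal.ofReal (Ψ.smoothNorm k a) +
      ∑ α ∈ Finset.piAntidiag (Finset.univ : Finset (Fin d)) k,
        Ψ.zygmundSeminorm (r - k) (Ψ.multiGen α a)
  else ∞

/-- The Hölder–Zygmund space `Λ_r(A)`. -/
def holderSpace (r : ℝ) : Set A := {a | Ψ.holderNorm r a < ∞}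

/-! ### Spectrum and bandlimited elements -/

theorem continuous_orbit {a : A} (ha : a ∈ Ψ.contElements) :
    Continuous fun t : EuclideanSpace ℝ (Fin d) => Ψ.psi t a := by
  obtain ⟨M, hM⟩ := Ψ.bounded
  rw [continuous_iff_continuousAt]
  intro s
  have h0 : Filter.Tendsto (fun t : EuclideanSpace ℝ (Fin d) => t - s) (nhds s) (nhds 0) := by
    have h : Continuous fun t : EuclideanSpace ℝ (Fin d) => t - s := by fun_prop
    simpa using h.tendsto s
  have h1 := ((show Filter.Tendsto _ _ _ from ha).comp h0).const_mul M
  rw [mul_zero] at h1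
  rw [ContinuousAt, tendsto_iff_norm_sub_tendsto_zero]
  refine squeeze_zero (fun _ => norm_nonneg _) (fun t => ?_) h1
  have h2 : Ψ.psi t a - Ψ.psi s a = Ψ.psi s (Ψ.psi (t - s) a - a) := by
    rw [map_sub, ← Ψ.psi_add, add_sub_cancel]
  rw [h2]
  exact hM _ _

/-- The function `G_{f,a}(t) = ⟨f, ψ_t(a)⟩` is essentially bounded if `a ∈ C(A)`. -/
theorem memLp_orbit (f : StrongDual ℂ A) {a : A} (ha : a ∈ Ψ.contElements) :
    MeasureTheory.MemLp (fun t : EuclideanSpace ℝ (Fin d) => f (Ψ.psi t a)) ∞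
      MeasureTheory.volume := by
  obtain ⟨M, hM⟩ := Ψ.bounded
  refine MeasureTheory.memLp_top_of_bound
    (f.continuous.comp (Ψ.continuous_orbit ha)).aestronglyMeasurable (‖f‖ * (M * ‖a‖))
    (Filter.Eventually.of_forall fun t => ?_)
  exact (f.le_opNorm _).trans (mul_le_mul_of_nonneg_left (hM t a) (norm_nonneg _))

/-- The function `G_{f,a}(t) = ⟨f, ψ_t(a)⟩` as a tempered distribution, for `a ∈ C(A)`. -/
def orbitDistribution (f : StrongDual ℂ A) (a : A) (ha : a ∈ Ψ.contElements) :
    𝓢'(EuclideanSpace ℝ (Fin d), ℂ) :=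
  MeasureTheory.Lp.toTemperedDistribution (Ψ.memLp_orbit f ha).toLp

theorem orbitDistribution_apply (f : StrongDual ℂ A) (a : A) (ha : a ∈ Ψ.contElements)
    (g : 𝓢(EuclideanSpace ℝ (Fin d), ℂ)) :
    Ψ.orbitDistribution f a ha g = ∫ t, g t * f (Ψ.psi t a) := by
  rw [orbitDistribution, MeasureTheory.Lp.toTemperedDistribution_apply]
  refine MeasureTheory.integral_congr_ae ?_
  filter_upwards [(Ψ.memLp_orbit f ha).coeFn_toLp] with t ht
  rw [ht, smul_eq_mul]

/-- The spectrum of `a ∈ C(A)`: the union over all `f ∈ A'` of the supports of the distributional Fourier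
transforms of `G_{f,a}`. -/
def spec (a : A) (ha : a ∈ Ψ.contElements) : Set (EuclideanSpace ℝ (Fin d)) :=
  ⋃ f : StrongDual ℂ A, Distribution.dsupport
    (𝓕 (Ψ.orbitDistribution f a ha) : 𝓢'(EuclideanSpace ℝ (Fin d), ℂ))

/-- The bandlimited elements of bandwidth `σ`: `X_0 = {0}`, and
`X_σ = {a ∈ C(A) : spec(a) ⊆ [-σ, σ]^d}` for `σ > 0`. -/
def bandlimited (σ : ℝ≥0) : Set A :=
  if σ = 0 then {0}
  else {a | ∃ ha : a ∈ Ψ.contElements, Ψ.spec a ha ⊆ {ω | ∀ j, ω j ∈ Set.Icc (-(σ : ℝ)) σ}}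

/-! ### Approximation spaces -/

/-- The approximation error `E_σ(a) = inf {‖a - x‖ : x ∈ X_σ}`. -/
def approxError (σ : ℝ≥0) (a : A) : ℝ := ⨅ x : Ψ.bandlimited σ, ‖a - x‖

/-- `‖a‖_{E^∞_r} = sup_{σ ≥ 0} E_σ(a) (σ + 1)^r`. -/
def approxNorm (r : ℝ) (a : A) : ℝ≥0∞ :=
  ⨆ σ : ℝ≥0, ENNReal.ofReal (Ψ.approxError σ a * ((σ : ℝ) + 1) ^ r)

/-- The approximation space `E^∞_r(A)`. -/
def approxSpace (r : ℝ) : Set A := {a | Ψ.approxNorm r a < ∞}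

end AutomorphismGroup

end

/-!
The proof runs through the functional calculus `AutomorphismGroup.fcalc` of the group,
`u ↦ u(D) a = ∫ (𝓕 u)(t) ψ_t(a) dt`, for Schwartz symbols `u` and `a ∈ C(A)`. It is multiplicative
in `u` (`fcalc_fcalc`), `δ_j` acts on it by multiplying the symbol with `2πi x_j`
(`hasDerivAt_fcalc`), the norms of the operators with the dilated symbols `u(ρ ·)` are bounded
uniformly in `ρ` (`norm_fcalc_dilate_le`), and for `u(0) = 1` these operators tend to the identity
as `ρ → 0` (`tendsto_fcalc_dilate`).

The distributional definition of the spectrum enters in two places only. Since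
`𝓕 (G_{f,a}) (g) = f (g(D) a)`, symbols supported in `[-σ, σ]^d` map into the `σ`-bandlimited
elements (`fcalc_mem_bandlimited`), and symbols that equal `1` near `[-σ, σ]^d` reproduce the
`σ`-bandlimited elements (`fcalc_eq_self`). The latter uses that a tempered distribution vanishes
on test functions with compact support disjoint from its own support.

*Direct estimate.* Let `T` be the operator whose symbol is an even bump at scale `σ`, supported in
the cube. Then `(1 - T)^{k+1} a` differs from `a` by a bandlimited element, so its norm bounds
`E_σ(a)`. A factor `1 - T` gains `σ⁻¹` against first derivatives by the mean value estimate
(`norm_sub_fcalc_le_of_canGen`), and `σ^{-η}` against second differences because the kernel is even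
(`norm_sub_fcalc_le_of_diff`); `1 - T` commutes with derivatives, so `k` factors of the first kind
and one of the second give `σ^{-(k+η)}`. All words of length `k` in the generators occur here; they
reduce to the derivatives `δ^α` because iterated derivatives commute (`iterGen_perm`), which is
clear for symbols and follows in general by smoothing.

*Inverse estimate.* The operators `vp n`, with a symbol equal to `1` near `[-2^n, 2^n]^d`, are
near-best approximations, so the pieces `c_n = vp n a - vp (n-1) a` (with `c_0 = vp 0 a`) decay
like `2^{-nr}`. They are reproduced by `vp (n+1)`, which yields Bernstein's inequality
`‖δ_w c_n‖ ≤ C 2^{n(|w| - r)}` for every word `w`. Termwise differentiation of `a = ∑ c_n` gives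
`a ∈ C^k(A)`, and the second difference of a `k`-th derivative of `c_n` is bounded by
`min (2^{-nη}, |t|² 2^{n(2-η)})`, which sums to a multiple of `|t|^η` as `0 < η < 2`
(`exists_tsum_le_rpow`).
-/

noncomputable section

namespace AutomorphismGroup

open Filter Topology MeasureTheory

variable {d : ℕ} {A : Type*} [NormedRing A] [NormedAlgebra ℂ A] (Ψ : AutomorphismGroup d A)

/-! ### The group action and its continuous elements -/

@[simp] theorem psi_zero (a : A) : Ψ.psi 0 a = a :=
  (Ψ.psi 0).injective (by rw [← Ψ.psi_add, add_zero])

/-- A bound `≥ 1` for the norms of all the automorphisms `ψ_t`. -/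
def opBound : ℝ := max 1 Ψ.bounded.choose

theorem one_le_opBound : 1 ≤ Ψ.opBound := le_max_left _ _

theorem opBound_pos : 0 < Ψ.opBound := one_pos.trans_le Ψ.one_le_opBound

theorem norm_psi_le (t : EuclideanSpace ℝ (Fin d)) (a : A) : ‖Ψ.psi t a‖ ≤ Ψ.opBound * ‖a‖ :=
  (Ψ.bounded.choose_spec t a).trans
    (mul_le_mul_of_nonneg_right (le_max_right _ _) (norm_nonneg _))

theorem psi_comm (s t : EuclideanSpace ℝ (Fin d)) (a : A) :
    Ψ.psi s (Ψ.psi t a) = Ψ.psi t (Ψ.psi s a) := by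
  rw [← Ψ.psi_add, ← Ψ.psi_add, add_comm]

/-- `ψ_t` as a bounded linear operator. -/
def psiCLM (t : EuclideanSpace ℝ (Fin d)) : A →L[ℂ] A :=
  (Ψ.psi t).toLinearMap.mkContinuous Ψ.opBound (Ψ.norm_psi_le t)

@[simp] theorem psiCLM_apply (t : EuclideanSpace ℝ (Fin d)) (a : A) :
    Ψ.psiCLM t a = Ψ.psi t a := rfl

theorem mem_contElements {a : A} :
    a ∈ Ψ.contElements ↔ Tendsto (fun t => Ψ.psi t a) (𝓝 0) (𝓝 a) :=
  tendsto_iff_norm_sub_tendsto_zero.symm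

/-- The continuous elements form a linear subspace. -/
def contSubmodule : Submodule ℂ A where
  carrier := Ψ.contElements
  zero_mem' := by simp [mem_contElements]
  add_mem' {a b} ha hb := by
    rw [mem_contElements] at *
    simpa using ha.add hb
  smul_mem' c a ha := by
    rw [mem_contElements] at *
    simpa using ha.const_smul c

theorem psi_mem_contElements {a : A} (ha : a ∈ Ψ.contElements) (s : EuclideanSpace ℝ (Fin d)) :
    Ψ.psi s a ∈ Ψ.contElements := by
  rw [mem_contElements] at *
  have := ((Ψ.psiCLM s).continuous.tendsto a).comp ha
  refine this.congr fun t => ?_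
  simp [Ψ.psi_comm s t]

theorem isClosed_contElements : IsClosed Ψ.contElements := by
  refine isClosed_of_closure_subset fun a ha => ?_
  rw [mem_contElements, Metric.tendsto_nhds]
  intro ε hε
  have hM := Ψ.opBound_pos
  obtain ⟨x, hx, hax⟩ := Metric.mem_closure_iff.1 ha (ε / (2 * (Ψ.opBound + 1))) (by positivity)
  have h1 := Metric.tendsto_nhds.1 (Ψ.mem_contElements.1 hx) (ε / 2) (by positivity)
  filter_upwards [h1] with t ht
  have h2 : Ψ.psi t a - a = Ψ.psi t (a - x) + (Ψ.psi t x - x) + (x - a) := by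
    rw [map_sub]; abel
  rw [dist_eq_norm] at *
  have h3 : (Ψ.opBound + 1) * ‖a - x‖ < ε / 2 := by
    rw [lt_div_iff₀ (by positivity)] at hax
    linarith
  calc ‖Ψ.psi t a - a‖ ≤ ‖Ψ.psi t (a - x)‖ + ‖Ψ.psi t x - x‖ + ‖x - a‖ := by
        rw [h2]; exact norm_add₃_le
    _ ≤ Ψ.opBound * ‖a - x‖ + ‖Ψ.psi t x - x‖ + ‖a - x‖ := by
        rw [norm_sub_rev x a]
        gcongr
        exact Ψ.norm_psi_le _ _
    _ < ε := by linarith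

/-! ### Generators and first differences -/

/-- The orbit along a direction is differentiable everywhere as soon as it is at `0`. -/
theorem hasDerivAt_orbit_of_zero {v : EuclideanSpace ℝ (Fin d)} {a b : A}
    (h : HasDerivAt (fun s : ℝ => Ψ.psi (s • v) a) b 0) (s : ℝ) :
    HasDerivAt (fun s : ℝ => Ψ.psi (s • v) a) (Ψ.psi (s • v) b) s := by
  have h1 : HasDerivAt (fun x : ℝ => Ψ.psi ((x - s) • v) a) b s := by
    have := HasDerivAt.comp_sub_const s s (f := fun s : ℝ => Ψ.psi (s • v) a) (f' := b)
      (by simpa using h)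
    simpa using this
  have h2 := ((Ψ.psiCLM (s • v)).restrictScalars ℝ).hasFDerivAt.comp_hasDerivAt s h1
  refine h2.congr_of_eventuallyEq (Eventually.of_forall fun x => ?_)
  simp [← Ψ.psi_add, ← add_smul]

theorem hasDerivAt_orbit {j : Fin d} {a : A} (ha : a ∈ Ψ.canDomain j) (s : ℝ) :
    HasDerivAt (fun s : ℝ => Ψ.psi (s • EuclideanSpace.single j 1) a)
      (Ψ.psi (s • EuclideanSpace.single j 1) (Ψ.canGen j a)) s :=
  Ψ.hasDerivAt_orbit_of_zero (DifferentiableAt.hasDerivAt ha) s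

theorem mem_canDomain_of_hasDerivAt {j : Fin d} {a b : A}
    (h : HasDerivAt (fun s : ℝ => Ψ.psi (s • EuclideanSpace.single j 1) a) b 0) :
    a ∈ Ψ.canDomain j := h.differentiableAt

theorem canGen_eq_of_hasDerivAt {j : Fin d} {a b : A}
    (h : HasDerivAt (fun s : ℝ => Ψ.psi (s • EuclideanSpace.single j 1) a) b 0) :
    Ψ.canGen j a = b := h.deriv

theorem hasDerivAt_canGen {j : Fin d} {a : A} (ha : a ∈ Ψ.canDomain j) :
    HasDerivAt (fun s : ℝ => Ψ.psi (s • EuclideanSpace.single j 1) a) (Ψ.canGen j a) 0 :=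
  DifferentiableAt.hasDerivAt ha

theorem sum_abs_pos {t : EuclideanSpace ℝ (Fin d)} (ht : t ≠ 0) : 0 < ∑ j, |t j| := by
  refine lt_of_le_of_ne (Finset.sum_nonneg fun _ _ => abs_nonneg _) fun h0 => ht ?_
  ext j
  have := (Finset.sum_eq_zero_iff_of_nonneg fun _ _ => abs_nonneg _).1 h0.symm j
    (Finset.mem_univ j)
  simpa using this

theorem norm_psi_smul_single_sub_le {j : Fin d} {a : A} (ha : a ∈ Ψ.canDomain j) (s : ℝ) :
    ‖Ψ.psi (s • EuclideanSpace.single j 1) a - a‖ ≤ Ψ.opBound * ‖Ψ.canGen j a‖ * |s| := by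
  have := Convex.norm_image_sub_le_of_norm_hasDerivWithin_le
    (f := fun s : ℝ => Ψ.psi (s • EuclideanSpace.single j 1) a)
    (fun x _ => (Ψ.hasDerivAt_orbit ha x).hasDerivWithinAt) (fun x _ => Ψ.norm_psi_le _ _)
    convex_univ (Set.mem_univ 0) (Set.mem_univ s)
  simpa using this

/-- The mean value estimate for the action, obtained by moving along one coordinate at a time. -/
theorem norm_psi_sub_le {a : A} (ha : ∀ j, a ∈ Ψ.canDomain j) {B : ℝ}
    (hB : ∀ j, ‖Ψ.canGen j a‖ ≤ B) (t : EuclideanSpace ℝ (Fin d)) :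
    ‖Ψ.psi t a - a‖ ≤ Ψ.opBound ^ 2 * B * ∑ j, |t j| := by
  have hM := Ψ.opBound_pos
  have key : ∀ s : Finset (Fin d),
      ‖Ψ.psi (∑ j ∈ s, t j • EuclideanSpace.single j (1 : ℝ)) a - a‖ ≤
        Ψ.opBound ^ 2 * B * ∑ j ∈ s, |t j| := by
    intro s
    induction s using Finset.induction_on with
    | empty => simp
    | insert i s hi ih =>
      rw [Finset.sum_insert hi, Finset.sum_insert hi, add_comm, Ψ.psi_add]
      set x := ∑ j ∈ s, t j • EuclideanSpace.single j (1 : ℝ)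
      set y := t i • EuclideanSpace.single i (1 : ℝ)
      have h1 : Ψ.psi x (Ψ.psi y a) - a = Ψ.psi x (Ψ.psi y a - a) + (Ψ.psi x a - a) := by
        rw [map_sub]; abel
      have h2 : ‖Ψ.psi y a - a‖ ≤ Ψ.opBound * B * |t i| :=
        (Ψ.norm_psi_smul_single_sub_le (ha i) (t i)).trans (by gcongr; exact hB i)
      calc _ ≤ Ψ.opBound * ‖Ψ.psi y a - a‖ + ‖Ψ.psi x a - a‖ := by
            rw [h1]; exact (norm_add_le _ _).trans (by gcongr; exact Ψ.norm_psi_le _ _)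
        _ ≤ Ψ.opBound * (Ψ.opBound * B * |t i|) + Ψ.opBound ^ 2 * B * ∑ j ∈ s, |t j| := by
            gcongr
        _ = _ := by ring
  have ht : ∑ j, t j • EuclideanSpace.single j (1 : ℝ) = t := by
    have := (EuclideanSpace.basisFun (Fin d) ℝ).sum_repr t
    simpa using this
  have := key Finset.univ
  rwa [ht] at this

theorem hasDerivAt_orbit_psi {j : Fin d} {a : A} (ha : a ∈ Ψ.canDomain j) (t : EuclideanSpace ℝ (Fin d)) :
    HasDerivAt (fun s : ℝ => Ψ.psi (s • EuclideanSpace.single j 1) (Ψ.psi t a))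
      (Ψ.psi t (Ψ.canGen j a)) 0 := by
  have h2 := ((Ψ.psiCLM t).restrictScalars ℝ).hasFDerivAt.comp_hasDerivAt 0
    (Ψ.hasDerivAt_canGen ha)
  refine h2.congr_of_eventuallyEq (Eventually.of_forall fun x => ?_)
  simp [Ψ.psi_comm t]

section

/-! ### Schwartz functions: products, dilations, coordinate multipliers -/

/-- The pointwise product of two Schwartz functions. -/
def mulSchwartz (u v : 𝓢(EuclideanSpace ℝ (Fin d), ℂ)) : 𝓢(EuclideanSpace ℝ (Fin d), ℂ) :=
  SchwartzMap.pairing (ContinuousLinearMap.mul ℂ ℂ) u v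

@[simp] theorem mulSchwartz_apply (u v : 𝓢(EuclideanSpace ℝ (Fin d), ℂ))
    (x : EuclideanSpace ℝ (Fin d)) : mulSchwartz u v x = u x * v x := rfl

/-- The dilation `x ↦ u (ρ x)` of a Schwartz function. -/
def dilate {ρ : ℝ} (hρ : 0 < ρ) (u : 𝓢(EuclideanSpace ℝ (Fin d), ℂ)) :
    𝓢(EuclideanSpace ℝ (Fin d), ℂ) :=
  SchwartzMap.compCLMOfContinuousLinearEquiv ℂ
    (LinearEquiv.smulOfNeZero ℝ (EuclideanSpace ℝ (Fin d)) ρ hρ.ne').toContinuousLinearEquiv u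

@[simp] theorem dilate_apply {ρ : ℝ} (hρ : 0 < ρ) (u : 𝓢(EuclideanSpace ℝ (Fin d), ℂ))
    (x : EuclideanSpace ℝ (Fin d)) : dilate hρ u x = u (ρ • x) := rfl

/-- Multiplication by `2πi x_j`, the symbol of the generator `δ_j`. -/
def coordMul (j : Fin d) (u : 𝓢(EuclideanSpace ℝ (Fin d), ℂ)) : 𝓢(EuclideanSpace ℝ (Fin d), ℂ) :=
  (2 * Real.pi * Complex.I) •
    SchwartzMap.smulLeftCLM ℂ (inner ℝ · (EuclideanSpace.single j (1 : ℝ))) u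

theorem coordMul_apply (j : Fin d) (u : 𝓢(EuclideanSpace ℝ (Fin d), ℂ))
    (x : EuclideanSpace ℝ (Fin d)) :
    coordMul j u x = 2 * Real.pi * Complex.I * (x j) * u x := by
  have h : (inner ℝ · (EuclideanSpace.single j (1 : ℝ)) :
    EuclideanSpace ℝ (Fin d) → ℝ).HasTemperateGrowth := by fun_prop
  rw [coordMul, smul_apply, SchwartzMap.smulLeftCLM_apply_apply h]
  simp [mul_assoc, EuclideanSpace.inner_single_right]

theorem coordMul_dilate (j : Fin d) {ρ : ℝ} (hρ : 0 < ρ)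
    (u : 𝓢(EuclideanSpace ℝ (Fin d), ℂ)) :
    coordMul j (dilate hρ u) = ((ρ⁻¹ : ℝ) : ℂ) • dilate hρ (coordMul j u) := by
  ext x
  have : (ρ : ℂ) ≠ 0 := by exact_mod_cast hρ.ne'
  simp [coordMul_apply]
  field_simp

theorem lineDeriv_fourier (j : Fin d) (u : 𝓢(EuclideanSpace ℝ (Fin d), ℂ))
    (x : EuclideanSpace ℝ (Fin d)) :
    fderiv ℝ (𝓕 u : 𝓢(EuclideanSpace ℝ (Fin d), ℂ)) x (EuclideanSpace.single j 1) = - 𝓕 (coordMul j u) x := by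
  have h := SchwartzMap.lineDerivOp_fourier_eq u (EuclideanSpace.single j (1 : ℝ))
  have h2 := congrArg (fun f : 𝓢(EuclideanSpace ℝ (Fin d), ℂ) => f x) h
  rw [neg_smul, FourierTransform.fourier_neg] at h2
  simpa [SchwartzMap.lineDerivOp_apply_eq_fderiv, coordMul] using h2

theorem integral_fourier (u : 𝓢(EuclideanSpace ℝ (Fin d), ℂ)) : ∫ t, 𝓕 u t = u 0 := by
  have h : (𝓕⁻ (𝓕 u) : 𝓢(EuclideanSpace ℝ (Fin d), ℂ)) 0 = u 0 := by simp
  rw [← h, SchwartzMap.fourierInv_coe, Real.fourierInv_eq]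
  simp

/-- The Fourier transform turns products into convolutions; this makes the functional calculus
multiplicative. -/
theorem fourier_convolution_eq (u v : 𝓢(EuclideanSpace ℝ (Fin d), ℂ))
    (t : EuclideanSpace ℝ (Fin d)) :
    ∫ s, 𝓕 u s * 𝓕 v (t - s) = 𝓕 (mulSchwartz u v) t := by
  set w := SchwartzMap.convolution (ContinuousLinearMap.mul ℂ ℂ) (𝓕 u) (𝓕 v) with hw
  have h1 : 𝓕⁻ w = mulSchwartz u v := by
    ext x
    rw [SchwartzMap.fourierInv_coe, Real.fourierInv_eq_fourier_neg, ← SchwartzMap.fourier_coe,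
      hw, SchwartzMap.fourier_convolution]
    rw [SchwartzMap.pairing_apply_apply]
    have h2 : ∀ u : 𝓢(EuclideanSpace ℝ (Fin d), ℂ), 𝓕 (𝓕 u) (-x) = u x := fun u => by
      have : (𝓕⁻ (𝓕 u) : 𝓢(EuclideanSpace ℝ (Fin d), ℂ)) x = u x := by simp
      rw [← this, SchwartzMap.fourierInv_coe, Real.fourierInv_eq_fourier_neg,
        ← SchwartzMap.fourier_coe]
    simp [h2]
  have h2 : 𝓕 (mulSchwartz u v) = w := by rw [← h1]; simp
  rw [h2, hw, SchwartzMap.convolution_apply]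
  rfl

theorem fourier_dilate {ρ : ℝ} (hρ : 0 < ρ) (u : 𝓢(EuclideanSpace ℝ (Fin d), ℂ))
    (t : EuclideanSpace ℝ (Fin d)) :
    𝓕 (dilate hρ u) t = ((ρ ^ d)⁻¹ : ℝ) • 𝓕 u (ρ⁻¹ • t) := by
  rw [SchwartzMap.fourier_coe, SchwartzMap.fourier_coe, Real.fourier_eq, Real.fourier_eq]
  have h := Measure.integral_comp_smul (volume : Measure (EuclideanSpace ℝ (Fin d)))
    (fun x => Real.fourierChar (-inner ℝ x (ρ⁻¹ • t)) • u x) ρ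
  rw [finrank_euclideanSpace_fin, abs_of_pos (by positivity)] at h
  rw [← h]
  refine integral_congr_ae (Eventually.of_forall fun x => ?_)
  simp [inner_smul_left, inner_smul_right, hρ.ne']

/-- All translates by vectors of norm `≤ 1` of a Schwartz function have a common integrable
majorant. -/
theorem exists_integrable_bound_translates (u : 𝓢(EuclideanSpace ℝ (Fin d), ℂ)) :
    ∃ g : EuclideanSpace ℝ (Fin d) → ℝ, Integrable g ∧ ∀ t s, ‖s‖ ≤ 1 → ‖u (t - s)‖ ≤ g t := by
  set C := 2 ^ (d + 1) * ((Finset.Iic (d + 1, 0)).sup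
    (fun m => SchwartzMap.seminorm ℝ m.1 m.2) u)
  refine ⟨fun t => 2 ^ (d + 1) * C * (1 + ‖t‖) ^ (-((d + 1 : ℕ) : ℝ)), ?_, fun t s hs => ?_⟩
  · refine Integrable.const_mul (integrable_one_add_norm ?_) _
    rw [finrank_euclideanSpace_fin]; push_cast; linarith
  · have h := SchwartzMap.one_add_le_sup_seminorm_apply (𝕜 := ℝ) (m := (d + 1, 0)) (k := d + 1)
      (n := 0) le_rfl le_rfl u (t - s)
    rw [norm_iteratedFDeriv_zero] at h
    have h1 : 1 + ‖t‖ ≤ 2 * (1 + ‖t - s‖) := by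
      have : ‖t‖ ≤ ‖t - s‖ + ‖s‖ := by simpa using norm_add_le (t - s) s
      have := norm_nonneg (t - s)
      linarith
    have hp : 0 < 1 + ‖t‖ := by positivity
    simp only
    rw [Real.rpow_neg hp.le, Real.rpow_natCast, ← div_eq_mul_inv, le_div_iff₀ (by positivity)]
    calc ‖u (t - s)‖ * (1 + ‖t‖) ^ (d + 1)
        ≤ ‖u (t - s)‖ * (2 * (1 + ‖t - s‖)) ^ (d + 1) := by gcongr
      _ = 2 ^ (d + 1) * ((1 + ‖t - s‖) ^ (d + 1) * ‖u (t - s)‖) := by rw [mul_pow]; ring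
      _ ≤ _ := by gcongr

/-- The `L¹` norm of the Fourier transform. -/
def fourierL1 (u : 𝓢(EuclideanSpace ℝ (Fin d), ℂ)) : ℝ := ∫ t, ‖𝓕 u t‖

theorem fourierL1_nonneg (u : 𝓢(EuclideanSpace ℝ (Fin d), ℂ)) : 0 ≤ fourierL1 u :=
  integral_nonneg fun _ => norm_nonneg _

/-! ### The functional calculus of the group -/

theorem integrable_smul_psi {κ : EuclideanSpace ℝ (Fin d) → ℂ} (hκ : Integrable κ) {a : A}
    (ha : a ∈ Ψ.contElements) (ρ : ℝ) : Integrable fun t => κ t • Ψ.psi (ρ • t) a := by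
  refine (hκ.norm.mul_const (Ψ.opBound * ‖a‖)).mono' ?_ (Eventually.of_forall fun t => ?_)
  · exact hκ.aestronglyMeasurable.smul
      ((Ψ.continuous_orbit ha).comp (continuous_const_smul ρ)).aestronglyMeasurable
  · rw [norm_smul]
    gcongr
    exact Ψ.norm_psi_le _ _

/-- The functional calculus of the group: `u ↦ ∫ (𝓕 u)(t) ψ_t(a) dt`. It is multiplicative in `u`,
and `u` is the symbol of the operator: `δ_j` corresponds to `2πi x_j`. -/
def fcalc (u : 𝓢(EuclideanSpace ℝ (Fin d), ℂ)) (a : A) : A := ∫ t, 𝓕 u t • Ψ.psi t a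

theorem integrable_fcalc (u : 𝓢(EuclideanSpace ℝ (Fin d), ℂ)) {a : A} (ha : a ∈ Ψ.contElements) :
    Integrable fun t => 𝓕 u t • Ψ.psi t a := by
  simpa using Ψ.integrable_smul_psi (𝓕 u).integrable ha 1

theorem fcalc_dilate {ρ : ℝ} (hρ : 0 < ρ) (u : 𝓢(EuclideanSpace ℝ (Fin d), ℂ)) (a : A) :
    Ψ.fcalc (dilate hρ u) a = ∫ t, 𝓕 u t • Ψ.psi (ρ • t) a := by
  have h := Measure.integral_comp_inv_smul (volume : Measure (EuclideanSpace ℝ (Fin d)))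
    (fun t => 𝓕 u t • Ψ.psi (ρ • t) a) ρ
  rw [finrank_euclideanSpace_fin, abs_of_pos (by positivity)] at h
  rw [fcalc, ← one_smul ℝ (∫ t, 𝓕 u t • Ψ.psi (ρ • t) a),
    ← inv_mul_cancel₀ (pow_pos hρ d).ne', mul_smul, ← h, ← integral_smul]
  refine integral_congr_ae (Eventually.of_forall fun t => ?_)
  simp only
  rw [fourier_dilate, smul_inv_smul₀ hρ.ne', smul_assoc]

theorem norm_fcalc_dilate_le {ρ : ℝ} (hρ : 0 < ρ) (u : 𝓢(EuclideanSpace ℝ (Fin d), ℂ)) (a : A) :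
    ‖Ψ.fcalc (dilate hρ u) a‖ ≤ Ψ.opBound * fourierL1 u * ‖a‖ := by
  rw [fcalc_dilate]
  calc _ ≤ ∫ t, ‖𝓕 u t‖ * (Ψ.opBound * ‖a‖) := by
        refine norm_integral_le_of_norm_le ((𝓕 u).integrable.norm.mul_const _)
          (Eventually.of_forall fun t => ?_)
        rw [norm_smul]
        gcongr
        exact Ψ.norm_psi_le _ _
    _ = _ := by rw [integral_mul_const, fourierL1]; ring

theorem norm_fcalc_le (u : 𝓢(EuclideanSpace ℝ (Fin d), ℂ)) (a : A) :
    ‖Ψ.fcalc u a‖ ≤ Ψ.opBound * fourierL1 u * ‖a‖ := by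
  have h : dilate one_pos u = u := by ext; simp
  simpa [h] using Ψ.norm_fcalc_dilate_le one_pos u a

theorem fcalc_add (u : 𝓢(EuclideanSpace ℝ (Fin d), ℂ)) {a b : A} (ha : a ∈ Ψ.contElements)
    (hb : b ∈ Ψ.contElements) : Ψ.fcalc u (a + b) = Ψ.fcalc u a + Ψ.fcalc u b := by
  simp only [fcalc]
  rw [← integral_add (Ψ.integrable_fcalc u ha) (Ψ.integrable_fcalc u hb)]
  simp

theorem fcalc_smul (u : 𝓢(EuclideanSpace ℝ (Fin d), ℂ)) (c : ℂ) (a : A) :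
    Ψ.fcalc u (c • a) = c • Ψ.fcalc u a := by
  simp only [fcalc]
  rw [← integral_smul]
  simp [smul_comm c]

theorem fcalc_sub (u : 𝓢(EuclideanSpace ℝ (Fin d), ℂ)) {a b : A} (ha : a ∈ Ψ.contElements)
    (hb : b ∈ Ψ.contElements) : Ψ.fcalc u (a - b) = Ψ.fcalc u a - Ψ.fcalc u b := by
  simp only [fcalc]
  rw [← integral_sub (Ψ.integrable_fcalc u ha) (Ψ.integrable_fcalc u hb)]
  simp [smul_sub]

theorem fcalc_smul_left (c : ℂ) (u : 𝓢(EuclideanSpace ℝ (Fin d), ℂ)) (a : A) :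
    Ψ.fcalc (c • u) a = c • Ψ.fcalc u a := by
  simp only [fcalc, FourierTransform.fourier_smul]
  rw [← integral_smul]
  simp [mul_smul]

theorem fcalc_sub_left (u v : 𝓢(EuclideanSpace ℝ (Fin d), ℂ)) {a : A} (ha : a ∈ Ψ.contElements) :
    Ψ.fcalc (u - v) a = Ψ.fcalc u a - Ψ.fcalc v a := by
  simp only [fcalc]
  rw [← integral_sub (Ψ.integrable_fcalc u ha) (Ψ.integrable_fcalc v ha)]
  simp [sub_eq_add_neg, FourierTransform.fourier_add, FourierTransform.fourier_neg, add_smul]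

@[simp] theorem fcalc_zero_left (a : A) : Ψ.fcalc (0 : 𝓢(EuclideanSpace ℝ (Fin d), ℂ)) a = 0 := by
  simpa using Ψ.fcalc_smul_left 0 0 a

variable [CompleteSpace A]

theorem psi_fcalc (u : 𝓢(EuclideanSpace ℝ (Fin d), ℂ)) {a : A} (ha : a ∈ Ψ.contElements)
    (s : EuclideanSpace ℝ (Fin d)) : Ψ.psi s (Ψ.fcalc u a) = Ψ.fcalc u (Ψ.psi s a) := by
  have h := (Ψ.psiCLM s).integral_comp_comm (Ψ.integrable_fcalc u ha)
  simp only [psiCLM_apply] at h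
  rw [fcalc, fcalc, ← h]
  simp [Ψ.psi_comm s]

theorem fcalc_mem_contElements (u : 𝓢(EuclideanSpace ℝ (Fin d), ℂ)) {a : A}
    (ha : a ∈ Ψ.contElements) : Ψ.fcalc u a ∈ Ψ.contElements := by
  have h : Tendsto (fun t => ‖Ψ.psi t a - a‖) (𝓝 0) (𝓝 0) := ha
  refine squeeze_zero (fun _ => norm_nonneg _) (fun t => ?_)
    (by simpa using h.const_mul (Ψ.opBound * fourierL1 u))
  rw [Ψ.psi_fcalc u ha, ← Ψ.fcalc_sub u (Ψ.psi_mem_contElements ha t) ha]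
  exact Ψ.norm_fcalc_le _ _

theorem fcalc_fcalc (u v : 𝓢(EuclideanSpace ℝ (Fin d), ℂ)) {a : A} (ha : a ∈ Ψ.contElements) :
    Ψ.fcalc u (Ψ.fcalc v a) = Ψ.fcalc (mulSchwartz u v) a := by
  -- Substituting `t - s` for `t` exhibits the convolution kernel.
  have h1 : ∀ s, 𝓕 u s • Ψ.psi s (Ψ.fcalc v a) =
      ∫ t, (𝓕 u s * 𝓕 v (t - s)) • Ψ.psi t a := by
    intro s
    have h := (Ψ.psiCLM s).integral_comp_comm (Ψ.integrable_fcalc v ha)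
    rw [fcalc, ← psiCLM_apply, ← h, ← integral_smul,
      ← integral_sub_right_eq_self _ s]
    refine integral_congr_ae (Eventually.of_forall fun t => ?_)
    simp [← Ψ.psi_add, mul_smul]
  have h2 : Integrable (fun p : EuclideanSpace ℝ (Fin d) × EuclideanSpace ℝ (Fin d) =>
      (𝓕 u p.1 * 𝓕 v (p.2 - p.1)) • Ψ.psi p.2 a) (volume.prod volume) := by
    have h3 := ((𝓕 u).integrable (μ := volume)).convolution_integrand
      (ContinuousLinearMap.mul ℂ ℂ) ((𝓕 v).integrable (μ := volume))
    have h4 : Integrable (fun p : EuclideanSpace ℝ (Fin d) × EuclideanSpace ℝ (Fin d) =>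
      (𝓕 u p.1 * 𝓕 v (p.2 - p.1))) (volume.prod volume) := h3.swap
    refine (h4.norm.mul_const (Ψ.opBound * ‖a‖)).mono' ?_ (Eventually.of_forall fun t => ?_)
    · exact h4.aestronglyMeasurable.smul
        ((Ψ.continuous_orbit ha).comp continuous_snd).aestronglyMeasurable
    · rw [norm_smul]
      gcongr
      exact Ψ.norm_psi_le _ _
  rw [fcalc]
  simp_rw [h1]
  rw [integral_integral_swap h2, fcalc]
  refine integral_congr_ae (Eventually.of_forall fun t => ?_)
  simp only
  rw [integral_smul_const, fourier_convolution_eq]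

/-- Differentiation of the functional calculus: `δ_j` acts on the symbol as `2πi x_j`. -/
theorem hasDerivAt_fcalc (u : 𝓢(EuclideanSpace ℝ (Fin d), ℂ)) {a : A} (ha : a ∈ Ψ.contElements)
    (j : Fin d) :
    HasDerivAt (fun h : ℝ => Ψ.psi (h • EuclideanSpace.single j 1) (Ψ.fcalc u a))
      (Ψ.fcalc (coordMul j u) a) 0 := by
  set e : EuclideanSpace ℝ (Fin d) := EuclideanSpace.single j 1 with he
  have he1 : ‖e‖ = 1 := by simp [he]
  have h1 : ∀ h : ℝ, Ψ.psi (h • e) (Ψ.fcalc u a) = ∫ t, 𝓕 u (t - h • e) • Ψ.psi t a := by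
    intro h
    rw [Ψ.psi_fcalc u ha, fcalc, ← integral_sub_right_eq_self _ (h • e)]
    simp [← Ψ.psi_add]
  -- The translation now acts on the smooth kernel, so no smoothness of `a` is needed.
  obtain ⟨g, hg, hgb⟩ := exists_integrable_bound_translates (𝓕 (coordMul j u))
  have hcont : Continuous fun t => Ψ.psi t a := Ψ.continuous_orbit ha
  have key := (hasDerivAt_integral_of_dominated_loc_of_deriv_le
    (μ := (volume : Measure (EuclideanSpace ℝ (Fin d)))) (𝕜 := ℝ) (x₀ := 0)
    (s := Metric.ball 0 1) (F := fun h t => 𝓕 u (t - h • e) • Ψ.psi t a)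
    (F' := fun h t => 𝓕 (coordMul j u) (t - h • e) • Ψ.psi t a)
    (bound := fun t => g t * (Ψ.opBound * ‖a‖)) (Metric.ball_mem_nhds _ one_pos)
    (Eventually.of_forall fun h => ?_) ?_ ?_ ?_ ?_ ?_).2
  · simp only [zero_smul, sub_zero] at key
    simp only [h1]
    exact key
  · exact (((𝓕 u).continuous.comp (continuous_id.sub continuous_const)).smul
      hcont).aestronglyMeasurable
  · simpa using Ψ.integrable_fcalc u ha
  · exact (((𝓕 (coordMul j u)).continuous.comp (continuous_id.sub continuous_const)).smul
      hcont).aestronglyMeasurable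
  · refine Eventually.of_forall fun t h hh => ?_
    have hh1 : ‖h • e‖ ≤ 1 := by
      rw [norm_smul, he1, mul_one]
      exact (by simpa using hh : |h| < 1).le
    rw [norm_smul]
    gcongr
    · exact (norm_nonneg _).trans (hgb t 0 (by simp))
    · exact hgb t _ hh1
    · exact Ψ.norm_psi_le _ _
  · exact hg.mul_const _
  · refine Eventually.of_forall fun t h _ => ?_
    have h2 : HasDerivAt (fun h : ℝ => t - h • e) (-e) h := by
      simpa using ((hasDerivAt_id h).smul_const e).const_sub t
    have h3 := ((𝓕 u).hasFDerivAt (t - h • e)).comp_hasDerivAt h h2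
    have h4 := h3.smul_const (Ψ.psi t a)
    refine h4.congr_deriv ?_
    rw [map_neg, he, lineDeriv_fourier, neg_neg]

theorem fcalc_mem_canDomain (u : 𝓢(EuclideanSpace ℝ (Fin d), ℂ)) {a : A}
    (ha : a ∈ Ψ.contElements) (j : Fin d) : Ψ.fcalc u a ∈ Ψ.canDomain j :=
  Ψ.mem_canDomain_of_hasDerivAt (Ψ.hasDerivAt_fcalc u ha j)

theorem canGen_fcalc (u : 𝓢(EuclideanSpace ℝ (Fin d), ℂ)) {a : A}
    (ha : a ∈ Ψ.contElements) (j : Fin d) :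
    Ψ.canGen j (Ψ.fcalc u a) = Ψ.fcalc (coordMul j u) a :=
  Ψ.canGen_eq_of_hasDerivAt (Ψ.hasDerivAt_fcalc u ha j)

/-- The functional calculus commutes with the generators. -/
theorem fcalc_canGen (u : 𝓢(EuclideanSpace ℝ (Fin d), ℂ)) {a : A} {j : Fin d}
    (ha : a ∈ Ψ.contElements) (haj : a ∈ Ψ.canDomain j) (hja : Ψ.canGen j a ∈ Ψ.contElements) :
    Ψ.fcalc u (Ψ.canGen j a) = Ψ.canGen j (Ψ.fcalc u a) := by
  refine (Ψ.canGen_eq_of_hasDerivAt ?_).symm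
  have h := hasDerivAt_iff_isLittleO.1 (Ψ.hasDerivAt_canGen haj)
  rw [hasDerivAt_iff_isLittleO]
  refine Asymptotics.IsBigO.trans_isLittleO
    (Asymptotics.IsBigO.of_bound (Ψ.opBound * fourierL1 u) (Eventually.of_forall fun x => ?_)) h
  have h1 : ∀ t, Ψ.psi t a ∈ Ψ.contSubmodule := fun t => Ψ.psi_mem_contElements ha t
  -- By linearity the remainder for `fcalc u a` is `fcalc u` of the remainder for `a`.
  have h2 := Ψ.fcalc_sub u (a := Ψ.psi (x • EuclideanSpace.single j 1) a -
      Ψ.psi ((0 : ℝ) • EuclideanSpace.single j 1) a) (b := ((x - 0 : ℝ) : ℂ) • Ψ.canGen j a)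
      (Ψ.contSubmodule.sub_mem (h1 _) (h1 _)) (Ψ.contSubmodule.smul_mem _ hja)
  rw [Ψ.fcalc_sub u (h1 _) (h1 _), fcalc_smul] at h2
  simp only [Complex.coe_smul] at h2
  rw [Ψ.psi_fcalc u ha, Ψ.psi_fcalc u ha, ← h2]
  exact Ψ.norm_fcalc_le _ _

/-- Dilated symbols give an approximate identity. -/
theorem tendsto_fcalc_dilate (u : 𝓢(EuclideanSpace ℝ (Fin d), ℂ)) {a : A}
    (ha : a ∈ Ψ.contElements) {ρ : ℕ → ℝ} (hρ : ∀ n, 0 < ρ n) (hρ0 : Tendsto ρ atTop (𝓝 0)) :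
    Tendsto (fun n => Ψ.fcalc (dilate (hρ n) u) a) atTop (𝓝 (u 0 • a)) := by
  simp_rw [fcalc_dilate]
  rw [← integral_fourier u, ← integral_smul_const]
  refine tendsto_integral_of_dominated_convergence (fun t => ‖𝓕 u t‖ * (Ψ.opBound * ‖a‖))
    (fun n => (Ψ.integrable_smul_psi (𝓕 u).integrable ha (ρ n)).aestronglyMeasurable)
    ((𝓕 u).integrable.norm.mul_const _) (fun n => Eventually.of_forall fun t => ?_)
    (Eventually.of_forall fun t => ?_)
  · rw [norm_smul]
    gcongr
    exact Ψ.norm_psi_le _ _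
  · refine Tendsto.const_smul ?_ _
    refine (Ψ.mem_contElements.1 ha).comp ?_
    simpa using hρ0.smul_const t

end

section

/-! ### Tempered distributions and test functions off the support -/

/-- A bump function as a complex-valued Schwartz function. -/
def ofBump {c : EuclideanSpace ℝ (Fin d)} (f : ContDiffBump c) :
    𝓢(EuclideanSpace ℝ (Fin d), ℂ) :=
  HasCompactSupport.toSchwartzMap (f := fun x => ((f x : ℝ) : ℂ))
    (f.hasCompactSupport.comp_left (g := Complex.ofReal) Complex.ofReal_zero)
    (Complex.ofRealCLM.contDiff.comp f.contDiff)

@[simp] theorem ofBump_apply {c : EuclideanSpace ℝ (Fin d)} (f : ContDiffBump c)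
    (x : EuclideanSpace ℝ (Fin d)) : ofBump f x = (f x : ℂ) := rfl

theorem tsupport_ofBump_subset {c : EuclideanSpace ℝ (Fin d)} (f : ContDiffBump c) :
    tsupport (ofBump f) ⊆ Metric.closedBall c f.rOut := by
  refine closure_minimal (fun x hx => ?_) Metric.isClosed_closedBall
  by_contra h
  refine hx ?_
  have := f.zero_of_le_dist (x := x) (by simpa using (not_le.1 h).le)
  simp [this]

theorem tsupport_mulSchwartz_subset_left (u v : 𝓢(EuclideanSpace ℝ (Fin d), ℂ)) :
    tsupport (mulSchwartz u v) ⊆ tsupport u :=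
  closure_mono fun x hx => by
    rw [Function.mem_support, mulSchwartz_apply] at hx
    exact left_ne_zero_of_mul hx

/-- A tempered distribution kills compactly supported test functions whose support misses its own.
In place of a partition of unity, the test function is multiplied by finitely many factors
`1 - f_i`, where `f_i` is a bump function supported where the distribution vanishes; this does not
change the value of the distribution, and the resulting product is `0`. -/
theorem distribution_eq_zero_of_disjoint (T : 𝓢'(EuclideanSpace ℝ (Fin d), ℂ))
    (g : 𝓢(EuclideanSpace ℝ (Fin d), ℂ)) (hg : HasCompactSupport g)
    (hd : Disjoint (tsupport g) (Distribution.dsupport T)) : T g = 0 := by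
  have hloc : ∀ x ∈ tsupport g, ∃ f : ContDiffBump x,
      ∀ u : 𝓢(EuclideanSpace ℝ (Fin d), ℂ), tsupport u ⊆ Metric.closedBall x f.rOut → T u = 0 := by
    intro x hx
    obtain ⟨s, hs, hso, hxs⟩ :=
      (Distribution.notMem_dsupport_iff x).1 (Set.disjoint_left.1 hd hx)
    obtain ⟨ε, hε, hεs⟩ := Metric.isOpen_iff.1 hso x hxs
    refine ⟨⟨ε / 4, ε / 2, by positivity, by linarith⟩, fun u hu => hs u (hu.trans ?_)⟩
    exact (Metric.closedBall_subset_ball (by simp only; linarith)).trans hεs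
  choose! f hf using hloc
  have hprod : ∀ s : Finset (EuclideanSpace ℝ (Fin d)), (∀ x ∈ s, x ∈ tsupport g) →
      ∃ h : 𝓢(EuclideanSpace ℝ (Fin d), ℂ), T h = T g ∧
        ∀ y, h y = g y * ∏ x ∈ s, (1 - (f x y : ℂ)) := by
    classical
    intro s
    induction s using Finset.induction_on with
    | empty => exact fun _ => ⟨g, rfl, by simp⟩
    | insert x s hx ih =>
      intro hs
      obtain ⟨h, h1, h2⟩ := ih fun y hy => hs y (Finset.mem_insert_of_mem hy)
      refine ⟨h - mulSchwartz (ofBump (f x)) h, ?_, fun y => ?_⟩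
      · rw [map_sub, h1, hf x (hs x (Finset.mem_insert_self _ _)) _
          ((tsupport_mulSchwartz_subset_left _ _).trans (tsupport_ofBump_subset _)), sub_zero]
      · rw [Finset.prod_insert hx, sub_apply, mulSchwartz_apply, ofBump_apply, h2]
        ring
  obtain ⟨s, hs, hcov⟩ := hg.isCompact.elim_nhds_subcover
    (fun x => Metric.ball x (f x).rIn) fun x _ => Metric.ball_mem_nhds _ (f x).rIn_pos
  obtain ⟨h, h1, h2⟩ := hprod s hs
  have h0 : h = 0 := by
    ext y
    rw [h2, zero_apply]
    by_cases hy : y ∈ tsupport g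
    · obtain ⟨x, hx, hxy⟩ := Set.mem_iUnion₂.1 (hcov hy)
      rw [Finset.prod_eq_zero hx, mul_zero]
      rw [(f x).one_of_mem_closedBall (Metric.ball_subset_closedBall hxy)]
      simp
    · rw [image_eq_zero_of_notMem_tsupport hy, zero_mul]
  rw [← h1, h0, map_zero]

/-! ### Bandlimited elements -/

/-- The cube `[-σ, σ]^d`. -/
def cube (d : ℕ) (σ : ℝ) : Set (EuclideanSpace ℝ (Fin d)) := {ω | ∀ j, ω j ∈ Set.Icc (-σ) σ}

theorem isClosed_cube (σ : ℝ) : IsClosed (cube d σ) := by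
  have : cube d σ = ⋂ j, (fun ω : EuclideanSpace ℝ (Fin d) => ω j) ⁻¹' Set.Icc (-σ) σ := by
    ext; simp [cube]
  rw [this]
  exact isClosed_iInter fun j => isClosed_Icc.preimage (by fun_prop)

theorem closedBall_subset_cube (σ : ℝ) :
    Metric.closedBall (0 : EuclideanSpace ℝ (Fin d)) σ ⊆ cube d σ := by
  intro ω hω j
  rw [Set.mem_Icc, ← abs_le]
  rw [mem_closedBall_zero_iff] at hω
  exact (PiLp.norm_apply_le ω j).trans hω

theorem norm_le_of_mem_cube {σ : ℝ} {ω : EuclideanSpace ℝ (Fin d)} (hω : ω ∈ cube d σ) :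
    ‖ω‖ ≤ d * σ := by
  have h := (EuclideanSpace.basisFun (Fin d) ℝ).sum_repr ω
  rw [← h]
  refine (norm_sum_le _ _).trans ?_
  refine (Finset.sum_le_sum (g := fun _ => σ) fun j _ => ?_).trans (by simp)
  simpa [norm_smul, abs_le] using hω j

theorem mem_bandlimited_iff {σ : ℝ≥0} (hσ : 0 < σ) {a : A} :
    a ∈ Ψ.bandlimited σ ↔ ∃ ha : a ∈ Ψ.contElements, Ψ.spec a ha ⊆ cube d σ := by
  simp [bandlimited, hσ.ne', cube]

theorem bandlimited_subset_contElements (σ : ℝ≥0) : Ψ.bandlimited σ ⊆ Ψ.contElements := by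
  intro a ha
  rcases eq_zero_or_pos σ with rfl | hσ
  · have : a = 0 := by simpa [bandlimited] using ha
    rw [this]
    exact Ψ.contSubmodule.zero_mem
  · exact ((Ψ.mem_bandlimited_iff hσ).1 ha).1

variable [CompleteSpace A]

/-- The Fourier transform of an orbit distribution, in terms of the functional calculus. -/
theorem fourier_orbitDistribution_apply (f : StrongDual ℂ A) {a : A} (ha : a ∈ Ψ.contElements)
    (g : 𝓢(EuclideanSpace ℝ (Fin d), ℂ)) :
    (𝓕 (Ψ.orbitDistribution f a ha) : 𝓢'(EuclideanSpace ℝ (Fin d), ℂ)) g =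
      f (Ψ.fcalc g a) := by
  rw [TemperedDistribution.fourier_apply, orbitDistribution_apply, fcalc,
    ← f.integral_comp_comm (Ψ.integrable_fcalc g ha)]
  simp

/-- Symbols supported in the cube produce bandlimited elements. -/
theorem fcalc_mem_bandlimited {σ : ℝ≥0} (hσ : 0 < σ) {u : 𝓢(EuclideanSpace ℝ (Fin d), ℂ)}
    (hu : tsupport u ⊆ cube d σ) {a : A} (ha : a ∈ Ψ.contElements) :
    Ψ.fcalc u a ∈ Ψ.bandlimited σ := by
  refine (Ψ.mem_bandlimited_iff hσ).2 ⟨Ψ.fcalc_mem_contElements u ha, ?_⟩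
  refine Set.iUnion_subset fun f ω hω => ?_
  refine (Distribution.mem_dsupport_iff ω).1 hω _ (fun g hg => ?_) (isClosed_cube (σ : ℝ))
  have h0 : mulSchwartz g u = 0 := by
    ext x
    rw [mulSchwartz_apply, zero_apply]
    by_cases hx : x ∈ cube d σ
    · rw [image_eq_zero_of_notMem_tsupport fun h => hg h hx, zero_mul]
    · rw [image_eq_zero_of_notMem_tsupport fun h => hx (hu h), mul_zero]
  rw [fourier_orbitDistribution_apply, Ψ.fcalc_fcalc _ _ ha, h0, fcalc_zero_left, map_zero]

/-- Symbols that are compactly supported off the cube annihilate the bandlimited elements. -/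
theorem fcalc_eq_zero_of_bandlimited {σ : ℝ≥0} (hσ : 0 < σ) {a : A} (ha : a ∈ Ψ.bandlimited σ)
    {g : 𝓢(EuclideanSpace ℝ (Fin d), ℂ)} (hg : HasCompactSupport g)
    (hgs : Disjoint (tsupport g) (cube d σ)) : Ψ.fcalc g a = 0 := by
  obtain ⟨hac, hsp⟩ := (Ψ.mem_bandlimited_iff hσ).1 ha
  refine (SeparatingDual.eq_zero_iff_forall_dual_eq_zero (R := ℂ) _).2 fun f => ?_
  rw [← Ψ.fourier_orbitDistribution_apply f hac]
  refine distribution_eq_zero_of_disjoint _ _ hg (hgs.mono_right ?_)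
  exact (Set.subset_iUnion (fun f : StrongDual ℂ A => Distribution.dsupport
    (𝓕 (Ψ.orbitDistribution f a hac) : 𝓢'(EuclideanSpace ℝ (Fin d), ℂ))) f).trans hsp

/-- An element is determined by its images under compactly supported symbols. -/
theorem eq_zero_of_forall_fcalc {a : A} (ha : a ∈ Ψ.contElements)
    (h : ∀ g : 𝓢(EuclideanSpace ℝ (Fin d), ℂ), HasCompactSupport g → Ψ.fcalc g a = 0) :
    a = 0 := by
  set f : ContDiffBump (0 : EuclideanSpace ℝ (Fin d)) := ⟨1, 2, by norm_num, by norm_num⟩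
  have h1 := Ψ.tendsto_fcalc_dilate (ofBump f) ha (ρ := fun n => 1 / ((n : ℝ) + 1))
    (fun n => by positivity) tendsto_one_div_add_atTop_nhds_zero_nat
  have h2 : ofBump f 0 = 1 := by
    rw [ofBump_apply, f.one_of_mem_closedBall (by simp [f])]
    simp
  rw [h2, one_smul] at h1
  refine tendsto_nhds_unique h1 (tendsto_const_nhds.congr fun n => (h _ ?_).symm)
  have hc : HasCompactSupport (ofBump f) :=
    HasCompactSupport.of_support_subset_isCompact (isCompact_closedBall 0 f.rOut)
      (subset_closure.trans (tsupport_ofBump_subset f))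
  exact hc.comp_homeomorph (Homeomorph.smulOfNeZero (1 / ((n : ℝ) + 1)) (by positivity))

/-- A symbol equal to `1` near the cube reproduces the bandlimited elements. -/
theorem fcalc_eq_self {σ : ℝ≥0} (hσ : 0 < σ) {a : A} (ha : a ∈ Ψ.bandlimited σ)
    {u : 𝓢(EuclideanSpace ℝ (Fin d), ℂ)} {s : Set (EuclideanSpace ℝ (Fin d))} (hs : IsOpen s)
    (hcs : cube d σ ⊆ s) (hu : ∀ x ∈ s, u x = 1) : Ψ.fcalc u a = a := by
  have hac := Ψ.bandlimited_subset_contElements σ ha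
  have hua := Ψ.fcalc_mem_contElements u hac
  refine (sub_eq_zero.1 (Ψ.eq_zero_of_forall_fcalc (Ψ.contSubmodule.sub_mem hac hua)
    fun g hg => ?_)).symm
  rw [Ψ.fcalc_sub g hac hua, Ψ.fcalc_fcalc _ _ hac, ← Ψ.fcalc_sub_left _ _ hac]
  have hsupp : tsupport (g - mulSchwartz g u) ⊆ sᶜ := by
    refine closure_minimal (fun x hx hxs => hx ?_) hs.isClosed_compl
    rw [sub_apply, mulSchwartz_apply, hu x hxs, mul_one, sub_self]
  refine Ψ.fcalc_eq_zero_of_bandlimited hσ ha ?_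
    (Set.disjoint_left.2 fun x hx hxc => hsupp hx (hcs hxc))
  refine hg.mono fun x hx => ?_
  rw [Function.mem_support, sub_apply, mulSchwartz_apply] at hx
  intro h0
  simp [h0] at hx

end

section

/-! ### Smooth elements and iterated derivatives -/

theorem mem_smoothElements_zero {a : A} : a ∈ Ψ.smoothElements 0 ↔ a ∈ Ψ.contElements := by
  refine ⟨fun h => h [] (by simp), fun h w hw => ?_⟩
  have : w = [] := by simpa using hw
  rw [this]
  exact h

theorem smoothElements_subset_contElements (k : ℕ) : Ψ.smoothElements k ⊆ Ψ.contElements :=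
  fun _ ha => ha [] (by simp)

/-- The recursive description of `C^{k+1}(A)` on which all inductions over the order rest. -/
theorem mem_smoothElements_succ {k : ℕ} {a : A} :
    a ∈ Ψ.smoothElements (k + 1) ↔
      a ∈ Ψ.contElements ∧ ∀ j, a ∈ Ψ.canDomain j ∧ Ψ.canGen j a ∈ Ψ.smoothElements k := by
  refine ⟨fun h => ⟨h [] (by simp), fun j => ⟨(h [j] (by simp)).2.1, fun w hw => ?_⟩⟩,
    fun h => ?_⟩
  · exact (h (j :: w) (by simpa using hw)).2.2
  · intro w
    induction w with
    | nil => exact fun _ => h.1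
    | cons j w ih =>
      intro hw
      have hw' : w.length ≤ k := by simpa using hw
      exact ⟨ih (hw'.trans (Nat.le_succ k)), (h.2 j).1, (h.2 j).2 w hw'⟩

/-- The iterated derivative along a word; the head of the word acts first. -/
def iterGen (w : List (Fin d)) (a : A) : A := w.foldl (fun b j => Ψ.canGen j b) a

@[simp] theorem iterGen_nil (a : A) : Ψ.iterGen [] a = a := rfl

@[simp] theorem iterGen_cons (j : Fin d) (w : List (Fin d)) (a : A) :
    Ψ.iterGen (j :: w) a = Ψ.iterGen w (Ψ.canGen j a) := rfl

theorem iterGen_append (w w' : List (Fin d)) (a : A) :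
    Ψ.iterGen (w ++ w') a = Ψ.iterGen w' (Ψ.iterGen w a) := by
  simp [iterGen]

theorem iterGen_mem_smoothElements {w : List (Fin d)} {k : ℕ} {a : A}
    (ha : a ∈ Ψ.smoothElements (w.length + k)) : Ψ.iterGen w a ∈ Ψ.smoothElements k := by
  induction w generalizing a with
  | nil => simpa using ha
  | cons j w ih =>
    refine ih ?_
    rw [List.length_cons, add_right_comm] at ha
    exact ((Ψ.mem_smoothElements_succ.1 ha).2 j).2

/-- The symbol of an iterated derivative of `fcalc u`. -/
def wordMul (w : List (Fin d)) (u : 𝓢(EuclideanSpace ℝ (Fin d), ℂ)) :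
    𝓢(EuclideanSpace ℝ (Fin d), ℂ) := w.foldl (fun v j => coordMul j v) u

theorem wordMul_perm {w w' : List (Fin d)} (h : w.Perm w')
    (u : 𝓢(EuclideanSpace ℝ (Fin d), ℂ)) : wordMul w u = wordMul w' u := by
  have : RightCommutative fun (v : 𝓢(EuclideanSpace ℝ (Fin d), ℂ)) (j : Fin d) =>
      coordMul j v := ⟨fun v i j => by ext x; simp only [coordMul_apply]; ring⟩
  exact h.foldl_eq u

theorem wordMul_smul (w : List (Fin d)) (c : ℂ) (u : 𝓢(EuclideanSpace ℝ (Fin d), ℂ)) :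
    wordMul w (c • u) = c • wordMul w u := by
  induction w generalizing u with
  | nil => rfl
  | cons j w ih =>
    have : coordMul j (c • u) = c • coordMul j u := by
      ext x; simp only [coordMul_apply, smul_apply, smul_eq_mul]; ring
    change wordMul w (coordMul j (c • u)) = c • wordMul w (coordMul j u)
    rw [this, ih]

theorem wordMul_dilate (w : List (Fin d)) {ρ : ℝ} (hρ : 0 < ρ)
    (u : 𝓢(EuclideanSpace ℝ (Fin d), ℂ)) :
    wordMul w (dilate hρ u) = (((ρ⁻¹) ^ w.length : ℝ) : ℂ) • dilate hρ (wordMul w u) := by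
  induction w generalizing u with
  | nil => simp [wordMul]
  | cons j w ih =>
    change wordMul w (coordMul j (dilate hρ u)) = _ • dilate hρ (wordMul w (coordMul j u))
    rw [coordMul_dilate, wordMul_smul, ih, smul_smul, List.length_cons, pow_succ']
    norm_cast

/-- The word `1 … 1 2 … 2 …` attached to a multi-index. -/
def multiWord (α : Fin d → ℕ) : List (Fin d) :=
  ((List.finRange d).flatMap fun j => List.replicate (α j) j).reverse

theorem multiGen_eq_iterGen (α : Fin d → ℕ) (a : A) :
    Ψ.multiGen α a = Ψ.iterGen (multiWord α) a := by
  rw [multiGen, iterGen, multiWord, List.foldl_reverse]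

theorem length_multiWord (α : Fin d → ℕ) : (multiWord α).length = ∑ j, α j := by
  rw [multiWord, List.length_reverse, List.length_flatMap, Fin.sum_univ_def]
  simp

theorem perm_multiWord_count (w : List (Fin d)) : w.Perm (multiWord fun j => w.count j) := by
  rw [List.perm_iff_count]
  intro j
  rw [multiWord, List.count_reverse, List.count_flatMap]
  have : (List.map (List.count j ∘ fun i => List.replicate (w.count i) i) (List.finRange d)).sum =
      ∑ i, (List.count j ∘ fun i => List.replicate (w.count i) i) i := (Fin.sum_univ_def _).symm
  rw [this, Finset.sum_eq_single j]
  · simp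
  · intro i _ hi
    simp [List.count_replicate, hi]
  · simp

variable [CompleteSpace A]

theorem fcalc_mem_smoothElements (k : ℕ) (u : 𝓢(EuclideanSpace ℝ (Fin d), ℂ)) {a : A}
    (ha : a ∈ Ψ.contElements) : Ψ.fcalc u a ∈ Ψ.smoothElements k := by
  induction k generalizing u with
  | zero => exact Ψ.mem_smoothElements_zero.2 (Ψ.fcalc_mem_contElements u ha)
  | succ k ih =>
    refine Ψ.mem_smoothElements_succ.2 ⟨Ψ.fcalc_mem_contElements u ha, fun j =>
      ⟨Ψ.fcalc_mem_canDomain u ha j, ?_⟩⟩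
    rw [Ψ.canGen_fcalc u ha j]
    exact ih _

theorem iterGen_fcalc (w : List (Fin d)) (u : 𝓢(EuclideanSpace ℝ (Fin d), ℂ)) {a : A}
    (ha : a ∈ Ψ.contElements) : Ψ.iterGen w (Ψ.fcalc u a) = Ψ.fcalc (wordMul w u) a := by
  induction w generalizing u with
  | nil => rfl
  | cons j w ih => rw [iterGen_cons, Ψ.canGen_fcalc u ha j, ih]; rfl

theorem norm_iterGen_fcalc_dilate_le (w : List (Fin d)) {ρ : ℝ} (hρ : 0 < ρ)
    (u : 𝓢(EuclideanSpace ℝ (Fin d), ℂ)) {a : A} (ha : a ∈ Ψ.contElements) :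
    ‖Ψ.iterGen w (Ψ.fcalc (dilate hρ u) a)‖ ≤
      (ρ⁻¹) ^ w.length * (Ψ.opBound * fourierL1 (wordMul w u) * ‖a‖) := by
  rw [Ψ.iterGen_fcalc w _ ha, wordMul_dilate, fcalc_smul_left, norm_smul, Complex.norm_real,
    Real.norm_of_nonneg (by positivity)]
  gcongr
  exact Ψ.norm_fcalc_dilate_le hρ _ _

theorem fcalc_iterGen (w : List (Fin d)) (u : 𝓢(EuclideanSpace ℝ (Fin d), ℂ)) {a : A}
    (ha : a ∈ Ψ.smoothElements w.length) :
    Ψ.fcalc u (Ψ.iterGen w a) = Ψ.iterGen w (Ψ.fcalc u a) := by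
  induction w generalizing a with
  | nil => rfl
  | cons j w ih =>
    have h := Ψ.mem_smoothElements_succ.1 ha
    rw [iterGen_cons, ih (h.2 j).2, iterGen_cons, Ψ.fcalc_canGen u h.1 (h.2 j).1
      (Ψ.smoothElements_subset_contElements _ (h.2 j).2)]

/-- Iterated derivatives do not depend on the order of the generators. After smoothing both sides
are given by the same symbol, and an element is determined by its smoothings. -/
theorem iterGen_perm {w w' : List (Fin d)} (h : w.Perm w') {a : A}
    (ha : a ∈ Ψ.smoothElements w.length) : Ψ.iterGen w a = Ψ.iterGen w' a := by
  have ha' : a ∈ Ψ.smoothElements w'.length := h.length_eq ▸ ha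
  have hac := Ψ.smoothElements_subset_contElements _ ha
  have h1 := Ψ.smoothElements_subset_contElements _ (Ψ.iterGen_mem_smoothElements (k := 0) ha)
  have h2 := Ψ.smoothElements_subset_contElements _ (Ψ.iterGen_mem_smoothElements (k := 0) ha')
  refine sub_eq_zero.1 (Ψ.eq_zero_of_forall_fcalc (Ψ.contSubmodule.sub_mem h1 h2) fun g _ => ?_)
  rw [Ψ.fcalc_sub g h1 h2, Ψ.fcalc_iterGen w g ha, Ψ.fcalc_iterGen w' g ha',
    Ψ.iterGen_fcalc w g hac, Ψ.iterGen_fcalc w' g hac, wordMul_perm h, sub_self]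

theorem iterGen_eq_multiGen (w : List (Fin d)) {a : A} (ha : a ∈ Ψ.smoothElements w.length) :
    Ψ.iterGen w a = Ψ.multiGen (fun j => w.count j) a := by
  rw [multiGen_eq_iterGen, Ψ.iterGen_perm (perm_multiWord_count w) ha]

end

section

/-! ### The approximation error -/

theorem zero_mem_bandlimited (σ : ℝ≥0) : (0 : A) ∈ Ψ.bandlimited σ := by
  rcases eq_zero_or_pos σ with rfl | hσ
  · simp [bandlimited]
  · have h0 : (0 : A) ∈ Ψ.contElements := Ψ.contSubmodule.zero_mem
    refine (Ψ.mem_bandlimited_iff hσ).2 ⟨h0, ?_⟩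
    refine Set.iUnion_subset fun f ω hω => ?_
    refine (Distribution.mem_dsupport_iff ω).1 hω _ (fun g _ => ?_) (isClosed_cube (σ : ℝ))
    rw [TemperedDistribution.fourier_apply, orbitDistribution_apply]
    simp

theorem approxError_le {σ : ℝ≥0} {a x : A} (hx : x ∈ Ψ.bandlimited σ) :
    Ψ.approxError σ a ≤ ‖a - x‖ :=
  ciInf_le ⟨0, by rintro _ ⟨y, rfl⟩; exact norm_nonneg _⟩ (⟨x, hx⟩ : Ψ.bandlimited σ)

theorem approxError_le_norm (σ : ℝ≥0) (a : A) : Ψ.approxError σ a ≤ ‖a‖ := by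
  simpa using Ψ.approxError_le (a := a) (Ψ.zero_mem_bandlimited σ)

theorem approxError_nonneg (σ : ℝ≥0) (a : A) : 0 ≤ Ψ.approxError σ a :=
  Real.iInf_nonneg fun _ => norm_nonneg _

theorem approxError_zero (a : A) : Ψ.approxError 0 a = ‖a‖ := by
  refine le_antisymm (Ψ.approxError_le_norm 0 a) ?_
  have : Nonempty (Ψ.bandlimited 0) := ⟨⟨0, Ψ.zero_mem_bandlimited 0⟩⟩
  refine le_ciInf fun ⟨x, hx⟩ => ?_
  have : x = 0 := by simpa [bandlimited] using hx
  simp [this]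

theorem le_mul_approxError {σ : ℝ≥0} {a : A} {c K : ℝ}
    (h : ∀ x ∈ Ψ.bandlimited σ, c ≤ K * ‖a - x‖) (hK : 0 < K) :
    c ≤ K * Ψ.approxError σ a := by
  have : Nonempty (Ψ.bandlimited σ) := ⟨⟨0, Ψ.zero_mem_bandlimited σ⟩⟩
  rw [← div_le_iff₀' hK]
  exact le_ciInf fun ⟨x, hx⟩ => (div_le_iff₀' hK).2 (h x hx)

/-! ### The direct (Jackson) estimate -/

/-- A first moment of the Fourier transform, the constant in the estimates for smoothing errors. -/
def fourierMoment (u : 𝓢(EuclideanSpace ℝ (Fin d), ℂ)) : ℝ := ∫ t, ‖𝓕 u t‖ * (1 + ∑ j, |t j|)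

theorem integrable_fourierMoment (u : 𝓢(EuclideanSpace ℝ (Fin d), ℂ)) :
    Integrable fun t => ‖𝓕 u t‖ * (1 + ∑ j, |t j|) := by
  have h1 := (𝓕 u).integrable_pow_mul (volume : Measure (EuclideanSpace ℝ (Fin d))) 1
  have h2 := (𝓕 u).integrable (μ := (volume : Measure (EuclideanSpace ℝ (Fin d))))
  refine (h2.norm.add (h1.const_mul d)).mono' (Continuous.aestronglyMeasurable (by fun_prop))
    (Eventually.of_forall fun t => ?_)
  have h3 : ∑ j, |t j| ≤ d * ‖t‖ := by
    refine (Finset.sum_le_sum (g := fun _ => ‖t‖) fun j _ => ?_).trans (by simp)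
    exact PiLp.norm_apply_le t j
  rw [Real.norm_of_nonneg (by positivity)]
  simp only [pow_one, Pi.add_apply]
  have := mul_le_mul_of_nonneg_left h3 (norm_nonneg (𝓕 u t))
  linarith

theorem fourierMoment_nonneg (u : 𝓢(EuclideanSpace ℝ (Fin d), ℂ)) : 0 ≤ fourierMoment u :=
  integral_nonneg fun _ => by positivity

variable [CompleteSpace A]

/-- The error of a smoothing operator whose symbol is `1` at the origin, as an integral of
differences. -/
theorem sub_fcalc_dilate {ρ : ℝ} (hρ : 0 < ρ) {u : 𝓢(EuclideanSpace ℝ (Fin d), ℂ)} (hu : u 0 = 1)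
    {a : A} (ha : a ∈ Ψ.contElements) :
    Ψ.fcalc (dilate hρ u) a - a = ∫ t, 𝓕 u t • (Ψ.psi (ρ • t) a - a) := by
  simp_rw [smul_sub]
  rw [integral_sub (Ψ.integrable_smul_psi (𝓕 u).integrable ha ρ)
    ((𝓕 u).integrable.smul_const a), fcalc_dilate, integral_smul_const, integral_fourier, hu,
    one_smul]

/-- Smoothing at scale `ρ` costs one factor `ρ` on differentiable elements. -/
theorem norm_sub_fcalc_le_of_canGen {ρ : ℝ} (hρ : 0 < ρ) {u : 𝓢(EuclideanSpace ℝ (Fin d), ℂ)}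
    (hu : u 0 = 1) {a : A} (ha : a ∈ Ψ.contElements) (haj : ∀ j, a ∈ Ψ.canDomain j) {B : ℝ}
    (hB0 : 0 ≤ B) (hB : ∀ j, ‖Ψ.canGen j a‖ ≤ B) :
    ‖a - Ψ.fcalc (dilate hρ u) a‖ ≤ Ψ.opBound ^ 2 * fourierMoment u * (ρ * B) := by
  have hM := Ψ.opBound_pos
  rw [norm_sub_rev, Ψ.sub_fcalc_dilate hρ hu ha, fourierMoment, mul_comm (Ψ.opBound ^ 2),
    mul_assoc, ← integral_mul_const]
  refine norm_integral_le_of_norm_le ((integrable_fourierMoment u).mul_const _)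
    (Eventually.of_forall fun t => ?_)
  rw [norm_smul, mul_assoc]
  refine mul_le_mul_of_nonneg_left ((Ψ.norm_psi_sub_le haj hB _).trans ?_) (norm_nonneg _)
  have h1 : ∑ j, |(ρ • t) j| = ρ * ∑ j, |t j| := by
    simp [Finset.mul_sum, abs_mul, abs_of_pos hρ]
  rw [h1]
  have h2 : 0 ≤ Ψ.opBound ^ 2 * (ρ * B) := by positivity
  nlinarith

/-- For an even symbol first differences may be replaced by second differences. -/
theorem norm_sub_fcalc_le_of_diff {ρ : ℝ} (hρ : 0 < ρ) {u : 𝓢(EuclideanSpace ℝ (Fin d), ℂ)}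
    (hu : u 0 = 1) (hue : ∀ x, u (-x) = u x) {a : A} (ha : a ∈ Ψ.contElements) {η B : ℝ}
    (hη : 0 < η) (hη1 : η ≤ 1) (hB0 : 0 ≤ B)
    (hB : ∀ t, ‖(Ψ.diff t)^[2] a‖ ≤ B * (∑ j, |t j|) ^ η) :
    ‖a - Ψ.fcalc (dilate hρ u) a‖ ≤ Ψ.opBound ^ 2 * fourierMoment u * (ρ ^ η * B) := by
  have hM := Ψ.one_le_opBound
  have hM0 := Ψ.opBound_pos
  have hFe : ∀ t, 𝓕 u (-t) = 𝓕 u t := by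
    intro t
    rw [SchwartzMap.fourier_coe, Real.fourier_eq, Real.fourier_eq, ← integral_neg_eq_self]
    simp [hue]
  have hint : Integrable fun t => 𝓕 u t • (Ψ.psi (ρ • t) a - a) := by
    simp_rw [smul_sub]
    exact (Ψ.integrable_smul_psi (𝓕 u).integrable ha ρ).sub ((𝓕 u).integrable.smul_const a)
  -- Averaging over `t` and `-t` gives `ψ_s a + ψ_{-s} a - 2 a = ψ_{-s} (Δ_s² a)` with `s = ρ t`.
  have h1 : (2 : ℝ) • (Ψ.fcalc (dilate hρ u) a - a) =
      ∫ t, 𝓕 u t • Ψ.psi (-(ρ • t)) ((Ψ.diff (ρ • t))^[2] a) := by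
    have h2 : Ψ.fcalc (dilate hρ u) a - a = ∫ t, 𝓕 u t • (Ψ.psi (-(ρ • t)) a - a) := by
      rw [Ψ.sub_fcalc_dilate hρ hu ha, ← integral_neg_eq_self]
      simp [hFe]
    have h3 : Integrable fun t => 𝓕 u t • (Ψ.psi (-(ρ • t)) a - a) := by
      have := hint.comp_neg
      simpa [hFe] using this
    rw [two_smul]
    nth_rw 1 [Ψ.sub_fcalc_dilate hρ hu ha]
    rw [h2, ← integral_add hint h3]
    refine integral_congr_ae (Eventually.of_forall fun t => ?_)
    simp only [Function.iterate_succ, Function.iterate_zero, Function.comp_apply, id, diff,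
      map_sub, ← Ψ.psi_add]
    rw [← smul_add]
    simp only [neg_add_cancel_left, neg_add_cancel, psi_zero]
    congr 1
    abel
  have h2 : ‖(2 : ℝ) • (Ψ.fcalc (dilate hρ u) a - a)‖ ≤
      Ψ.opBound ^ 2 * fourierMoment u * (ρ ^ η * B) := by
    rw [h1, fourierMoment, mul_comm (Ψ.opBound ^ 2), mul_assoc, ← integral_mul_const]
    refine norm_integral_le_of_norm_le ((integrable_fourierMoment u).mul_const _)
      (Eventually.of_forall fun t => ?_)
    rw [norm_smul, mul_assoc]
    refine mul_le_mul_of_nonneg_left ((Ψ.norm_psi_le _ _).trans ?_) (norm_nonneg _)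
    have h3 : ∑ j, |(ρ • t) j| = ρ * ∑ j, |t j| := by
      simp [Finset.mul_sum, abs_mul, abs_of_pos hρ]
    have h4 := hB (ρ • t)
    set S := ∑ j, |t j| with hS
    have hS0 : 0 ≤ S := Finset.sum_nonneg fun _ _ => abs_nonneg _
    rw [h3, Real.mul_rpow hρ.le hS0] at h4
    have h5 : S ^ η ≤ 1 + S :=
      (Real.rpow_le_rpow hS0 (by linarith) hη.le).trans
        ((Real.rpow_le_rpow_of_exponent_le (by linarith) hη1).trans (Real.rpow_one _).le)
    have h6 : Ψ.opBound ≤ Ψ.opBound ^ 2 := by nlinarith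
    calc Ψ.opBound * ‖(Ψ.diff (ρ • t))^[2] a‖
        ≤ Ψ.opBound ^ 2 * (B * (ρ ^ η * (1 + S))) := by
          gcongr
          exact h4.trans (by gcongr)
      _ = _ := by ring
  rw [norm_smul, Real.norm_of_nonneg (by norm_num : (0 : ℝ) ≤ 2), norm_sub_rev] at h2
  linarith [norm_nonneg (a - Ψ.fcalc (dilate hρ u) a)]

/-- The error operator `1 - T` of smoothing with the symbol `u`. -/
def smoothingError (u : 𝓢(EuclideanSpace ℝ (Fin d), ℂ)) (a : A) : A := a - Ψ.fcalc u a

theorem smoothingError_mem_contElements (u : 𝓢(EuclideanSpace ℝ (Fin d), ℂ)) {a : A}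
    (ha : a ∈ Ψ.contElements) : Ψ.smoothingError u a ∈ Ψ.contElements :=
  Ψ.contSubmodule.sub_mem ha (Ψ.fcalc_mem_contElements u ha)

theorem canGen_smoothingError (u : 𝓢(EuclideanSpace ℝ (Fin d), ℂ)) {a : A} {j : Fin d}
    (ha : a ∈ Ψ.contElements) (haj : a ∈ Ψ.canDomain j) (hja : Ψ.canGen j a ∈ Ψ.contElements) :
    Ψ.smoothingError u a ∈ Ψ.canDomain j ∧
      Ψ.canGen j (Ψ.smoothingError u a) = Ψ.smoothingError u (Ψ.canGen j a) := by
  have h : HasDerivAt (fun s : ℝ => Ψ.psi (s • EuclideanSpace.single j 1) (Ψ.smoothingError u a))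
      (Ψ.smoothingError u (Ψ.canGen j a)) 0 := by
    rw [smoothingError, smoothingError, Ψ.fcalc_canGen u ha haj hja]
    refine ((Ψ.hasDerivAt_canGen haj).sub
      (Ψ.hasDerivAt_canGen (Ψ.fcalc_mem_canDomain u ha j))).congr_of_eventuallyEq
      (Eventually.of_forall fun s => ?_)
    simp
  exact ⟨Ψ.mem_canDomain_of_hasDerivAt h, Ψ.canGen_eq_of_hasDerivAt h⟩

theorem iterate_smoothingError_mem (u : 𝓢(EuclideanSpace ℝ (Fin d), ℂ)) {a : A}
    (ha : a ∈ Ψ.contElements) (n : ℕ) : (Ψ.smoothingError u)^[n] a ∈ Ψ.contElements := by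
  induction n with
  | zero => exact ha
  | succ n ih =>
    rw [Function.iterate_succ_apply']
    exact Ψ.smoothingError_mem_contElements u ih

theorem canGen_iterate_smoothingError (u : 𝓢(EuclideanSpace ℝ (Fin d), ℂ)) {a : A} {j : Fin d}
    (ha : a ∈ Ψ.contElements) (haj : a ∈ Ψ.canDomain j) (hja : Ψ.canGen j a ∈ Ψ.contElements)
    (n : ℕ) : (Ψ.smoothingError u)^[n] a ∈ Ψ.canDomain j ∧
      Ψ.canGen j ((Ψ.smoothingError u)^[n] a) = (Ψ.smoothingError u)^[n] (Ψ.canGen j a) := by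
  induction n with
  | zero => exact ⟨haj, rfl⟩
  | succ n ih =>
    rw [Function.iterate_succ_apply', Function.iterate_succ_apply', ← ih.2]
    refine Ψ.canGen_smoothingError u (Ψ.iterate_smoothingError_mem u ha n) ih.1 ?_
    rw [ih.2]
    exact Ψ.iterate_smoothingError_mem u hja n

/-- `(1 - T)^n = 1 - T P` for a polynomial `P` in `T`. -/
theorem exists_iterate_smoothingError_eq (u : 𝓢(EuclideanSpace ℝ (Fin d), ℂ)) {a : A}
    (ha : a ∈ Ψ.contElements) (n : ℕ) :
    ∃ y ∈ Ψ.contElements, (Ψ.smoothingError u)^[n] a = a - Ψ.fcalc u y := by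
  induction n with
  | zero =>
    refine ⟨0, Ψ.contSubmodule.zero_mem, ?_⟩
    have : Ψ.fcalc u (0 : A) = 0 := by simpa using Ψ.fcalc_smul u 0 (0 : A)
    simp [this]
  | succ n ih =>
    obtain ⟨y, hy, h⟩ := ih
    have h1 := Ψ.fcalc_mem_contElements u hy
    have h2 : a - Ψ.fcalc u y ∈ Ψ.contElements := Ψ.contSubmodule.sub_mem ha h1
    refine ⟨y + (a - Ψ.fcalc u y), Ψ.contSubmodule.add_mem hy h2, ?_⟩
    rw [Function.iterate_succ_apply', h, smoothingError, Ψ.fcalc_add u hy h2]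
    abel

/-- Each of the `k` derivatives gains one factor `ρ` through the mean value estimate, the second
differences gain the remaining `ρ ^ η`. -/
theorem norm_iterate_smoothingError_le {ρ : ℝ} (hρ : 0 < ρ)
    {u : 𝓢(EuclideanSpace ℝ (Fin d), ℂ)} (hu : u 0 = 1) (hue : ∀ x, u (-x) = u x) {η B : ℝ}
    (hη : 0 < η) (hη1 : η ≤ 1) (hB0 : 0 ≤ B) (k : ℕ) {a : A} (ha : a ∈ Ψ.smoothElements k)
    (hB : ∀ w : List (Fin d), w.length = k →
      ∀ t, ‖(Ψ.diff t)^[2] (Ψ.iterGen w a)‖ ≤ B * (∑ j, |t j|) ^ η) :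
    ‖(Ψ.smoothingError (dilate hρ u))^[k + 1] a‖ ≤
      (Ψ.opBound ^ 2 * fourierMoment u) ^ (k + 1) * ρ ^ k * (ρ ^ η * B) := by
  have hF := fourierMoment_nonneg u
  induction k generalizing a with
  | zero =>
    simpa [smoothingError] using Ψ.norm_sub_fcalc_le_of_diff hρ hu hue
      (Ψ.smoothElements_subset_contElements _ ha) hη hη1 hB0 (hB [] rfl)
  | succ k ih =>
    have h := Ψ.mem_smoothElements_succ.1 ha
    have h1 : ∀ j, _ := fun j => Ψ.canGen_iterate_smoothingError (dilate hρ u) h.1 (h.2 j).1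
      (Ψ.smoothElements_subset_contElements _ (h.2 j).2) (k + 1)
    rw [Function.iterate_succ_apply']
    refine (Ψ.norm_sub_fcalc_le_of_canGen hρ hu
      (B := (Ψ.opBound ^ 2 * fourierMoment u) ^ (k + 1) * ρ ^ k * (ρ ^ η * B))
      (Ψ.iterate_smoothingError_mem _ h.1 _) (fun j => (h1 j).1) (by positivity)
      fun j => ?_).trans_eq (by ring)
    rw [(h1 j).2]
    exact ih (h.2 j).2 fun w hw => hB (j :: w) (by simp [hw])

/-- The bump function whose dilates are the symbols in the direct estimate. -/
def innerBump (d : ℕ) : ContDiffBump (0 : EuclideanSpace ℝ (Fin d)) :=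
  ⟨1 / 2, 1, by norm_num, by norm_num⟩

theorem ofBump_zero (f : ContDiffBump (0 : EuclideanSpace ℝ (Fin d))) : ofBump f 0 = 1 := by
  rw [ofBump_apply, f.one_of_mem_closedBall (by simp [f.rIn_pos.le])]
  simp

/-- The direct estimate: `(1 - T)^{k+1} a` differs from `a` by a bandlimited element. -/
theorem approxError_le_of_diff {σ : ℝ≥0} (hσ : 0 < σ) {η B : ℝ}
    (hη : 0 < η) (hη1 : η ≤ 1) (hB0 : 0 ≤ B) (k : ℕ) {a : A} (ha : a ∈ Ψ.smoothElements k)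
    (hB : ∀ w : List (Fin d), w.length = k →
      ∀ t, ‖(Ψ.diff t)^[2] (Ψ.iterGen w a)‖ ≤ B * (∑ j, |t j|) ^ η) :
    Ψ.approxError σ a ≤ (Ψ.opBound ^ 2 * fourierMoment (ofBump (innerBump d))) ^ (k + 1) *
      (σ : ℝ) ^ (-(k + η)) * B := by
  have hσ' : (0 : ℝ) < σ := hσ
  have hρ : 0 < (σ : ℝ)⁻¹ := by positivity
  have h1 := Ψ.norm_iterate_smoothingError_le hρ (ofBump_zero (innerBump d))
    (fun x => by simp [(innerBump d).neg]) hη hη1 hB0 k ha hB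
  obtain ⟨y, hy, h2⟩ := Ψ.exists_iterate_smoothingError_eq (dilate hρ (ofBump (innerBump d)))
    (Ψ.smoothElements_subset_contElements _ ha) (k + 1)
  rw [h2] at h1
  refine (Ψ.approxError_le (Ψ.fcalc_mem_bandlimited hσ ?_ hy)).trans (h1.trans_eq ?_)
  · refine Set.Subset.trans ?_ (closedBall_subset_cube (d := d) (σ : ℝ))
    refine closure_minimal (fun x hx => ?_) Metric.isClosed_closedBall
    by_contra hxs
    refine hx ?_
    rw [dilate_apply, ofBump_apply, (innerBump d).zero_of_le_dist, Complex.ofReal_zero]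
    rw [mem_closedBall_zero_iff, not_le] at hxs
    rw [dist_zero_right, norm_smul, Real.norm_of_nonneg hρ.le, inv_mul_eq_div,
      le_div_iff₀ hσ']
    simpa [innerBump] using hxs.le
  · rw [neg_add, Real.rpow_add hσ', Real.rpow_neg hσ'.le, Real.rpow_natCast, Real.rpow_neg hσ'.le,
      Real.inv_rpow hσ'.le, inv_pow]
    ring

end

section

/-! ### A dyadic sum -/

/-- The dyadic sum behind the inverse estimate: the second bound is used up to `2 ^ n ≈ 1 / S`, the
first one beyond. -/
theorem exists_tsum_le_rpow {η : ℝ} (hη : 0 < η) (hη1 : η ≤ 1) :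
    ∃ C : ℝ, 0 ≤ C ∧ ∀ S : ℝ, 0 < S → ∀ x : ℕ → ℝ, (∀ n, 0 ≤ x n) →
      (∀ n, x n ≤ ((2 : ℝ) ^ (-η)) ^ n) → (∀ n, x n ≤ S ^ 2 * (4 * (2 : ℝ) ^ (-η)) ^ n) →
      Summable x ∧ ∑' n, x n ≤ C * S ^ η := by
  set θ : ℝ := (2 : ℝ) ^ (-η) with hθ
  have hθ0 : 0 < θ := by positivity
  have hθ1 : θ < 1 := Real.rpow_lt_one_of_one_lt_of_neg one_lt_two (by linarith)
  have hθ2 : 1 / 2 ≤ θ := by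
    have : (2 : ℝ) ^ (-1 : ℝ) ≤ (2 : ℝ) ^ (-η) :=
      Real.rpow_le_rpow_of_exponent_le one_le_two (by linarith)
    rw [Real.rpow_neg_one] at this
    linarith
  have hg : ∀ m : ℕ, ∑ n ∈ Finset.range m, (4 * θ) ^ n ≤ (4 * θ) ^ m := by
    intro m
    induction m with
    | zero => simp
    | succ m ih =>
      rw [Finset.sum_range_succ, pow_succ]
      have : 0 < (4 * θ) ^ m := by positivity
      nlinarith
  have h1θ : 0 < 1 - θ := by linarith
  have h2η : (1 : ℝ) ≤ 2 ^ η := Real.one_le_rpow one_le_two hη.le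
  refine ⟨2 ^ η * (1 + (1 - θ)⁻¹), by positivity, fun S hS x hx0 hx1 hx2 => ?_⟩
  have hgeo := summable_geometric_of_lt_one hθ0.le hθ1
  have hsum : Summable x := Summable.of_nonneg_of_le hx0 hx1 hgeo
  refine ⟨hsum, ?_⟩
  have htail : ∀ m, ∑' n, x (n + m) ≤ θ ^ m * (1 - θ)⁻¹ := by
    intro m
    rw [← tsum_geometric_of_lt_one hθ0.le hθ1, ← tsum_mul_left]
    refine Summable.tsum_le_tsum (fun n => ?_) ((summable_nat_add_iff m).2 hsum)
      (hgeo.mul_left _)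
    rw [← pow_add, add_comm m]
    exact hx1 _
  rcases le_total 1 S with h | h
  · have h3 := htail 0
    have h4 : 1 ≤ S ^ η := Real.one_le_rpow h hη.le
    have h5 : 0 < (1 - θ)⁻¹ := by positivity
    simp only [add_zero, pow_zero, one_mul] at h3
    have h6 : 1 * (1 * (1 - θ)⁻¹) ≤ 2 ^ η * (1 + (1 - θ)⁻¹) * S ^ η := by
      calc 1 * (1 * (1 - θ)⁻¹) ≤ 2 ^ η * (1 + (1 - θ)⁻¹) * 1 := by
            rw [one_mul, mul_one]; gcongr; linarith
        _ ≤ _ := by gcongr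
    linarith
  · obtain ⟨m, hm1, hm2⟩ := exists_nat_pow_near (one_le_inv₀ hS |>.2 h) (one_lt_two (α := ℝ))
    have hm3 : (2 : ℝ) ^ m * S ≤ 1 := by
      rw [← inv_inv S, ← div_eq_mul_inv]
      exact div_le_one_of_le₀ hm1 (by positivity)
    have hm4 : 1 ≤ 2 ^ (m + 1) * S := by
      rw [← inv_mul_cancel₀ hS.ne']
      gcongr
    have hθm : θ ^ m ≤ 2 ^ η * S ^ η := by
      have e1 : θ ^ m = ((2 : ℝ) ^ m) ^ (-η) := by
        rw [hθ, ← Real.rpow_natCast, ← Real.rpow_mul zero_le_two, mul_comm,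
          Real.rpow_mul zero_le_two, Real.rpow_natCast]
      rw [e1, Real.rpow_neg (by positivity), ← Real.mul_rpow zero_le_two hS.le,
        inv_le_iff_one_le_mul₀ (by positivity),
        ← Real.mul_rpow (by positivity) (by positivity)]
      refine Real.one_le_rpow ?_ hη.le
      rw [pow_succ] at hm4
      linarith
    have hhead : ∑ n ∈ Finset.range m, x n ≤ θ ^ m := by
      calc ∑ n ∈ Finset.range m, x n ≤ ∑ n ∈ Finset.range m, S ^ 2 * (4 * θ) ^ n :=
            Finset.sum_le_sum fun n _ => hx2 n
        _ = S ^ 2 * ∑ n ∈ Finset.range m, (4 * θ) ^ n := by rw [Finset.mul_sum]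
        _ ≤ S ^ 2 * (4 * θ) ^ m := by gcongr; exact hg m
        _ = (2 ^ m * S) ^ 2 * θ ^ m := by
            rw [mul_pow, mul_pow, ← pow_mul, mul_comm m 2, pow_mul]; norm_num; ring
        _ ≤ 1 * θ ^ m := by
            gcongr
            exact pow_le_one₀ (by positivity) hm3
        _ = θ ^ m := one_mul _
    rw [← hsum.sum_add_tsum_nat_add m]
    calc _ ≤ θ ^ m + θ ^ m * (1 - θ)⁻¹ := add_le_add hhead (htail m)
      _ = θ ^ m * (1 + (1 - θ)⁻¹) := by ring
      _ ≤ 2 ^ η * S ^ η * (1 + (1 - θ)⁻¹) := by gcongr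
      _ = _ := by ring

/-! ### Second differences and sums of smooth elements -/

theorem norm_diff_le (t : EuclideanSpace ℝ (Fin d)) (a : A) :
    ‖Ψ.diff t a‖ ≤ (Ψ.opBound + 1) * ‖a‖ := by
  rw [diff, add_mul, one_mul]
  exact (norm_sub_le _ _).trans (by gcongr; exact Ψ.norm_psi_le _ _)

theorem norm_diff_diff_le (t : EuclideanSpace ℝ (Fin d)) (a : A) :
    ‖(Ψ.diff t)^[2] a‖ ≤ (Ψ.opBound + 1) ^ 2 * ‖a‖ := by
  have := Ψ.opBound_pos
  calc ‖(Ψ.diff t)^[2] a‖ ≤ (Ψ.opBound + 1) * ((Ψ.opBound + 1) * ‖a‖) :=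
        (Ψ.norm_diff_le t _).trans (by gcongr; exact Ψ.norm_diff_le t a)
    _ = _ := by ring

/-- Two applications of the mean value estimate. -/
theorem norm_diff_diff_le_of_canGen {a : A} (ha : a ∈ Ψ.smoothElements 2) {B : ℝ}
    (hB : ∀ i j, ‖Ψ.canGen j (Ψ.canGen i a)‖ ≤ B) (t : EuclideanSpace ℝ (Fin d)) :
    ‖(Ψ.diff t)^[2] a‖ ≤ Ψ.opBound ^ 4 * B * (∑ j, |t j|) ^ 2 := by
  have h := Ψ.mem_smoothElements_succ.1 ha
  have h1 : ∀ i, HasDerivAt (fun s : ℝ => Ψ.psi (s • EuclideanSpace.single i 1) (Ψ.diff t a))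
      (Ψ.diff t (Ψ.canGen i a)) 0 := fun i => by
    refine ((Ψ.hasDerivAt_orbit_psi (h.2 i).1 t).sub
      (Ψ.hasDerivAt_canGen (h.2 i).1)).congr_of_eventuallyEq (Eventually.of_forall fun s => ?_)
    simp [diff]
  refine (Ψ.norm_psi_sub_le (B := Ψ.opBound ^ 2 * B * ∑ j, |t j|)
    (fun i => Ψ.mem_canDomain_of_hasDerivAt (h1 i)) (fun i => ?_) t).trans_eq (by ring)
  rw [Ψ.canGen_eq_of_hasDerivAt (h1 i)]
  exact Ψ.norm_psi_sub_le (fun j => ((Ψ.mem_smoothElements_succ.1 (h.2 i).2).2 j).1) (hB i) t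

theorem hasSum_diff_diff {c : ℕ → A} {a : A} (h : HasSum c a) (t : EuclideanSpace ℝ (Fin d)) :
    HasSum (fun n => (Ψ.diff t)^[2] (c n)) ((Ψ.diff t)^[2] a) := by
  have h1 : ∀ {c : ℕ → A} {a : A}, HasSum c a → HasSum (fun n => Ψ.diff t (c n)) (Ψ.diff t a) :=
    fun h => (h.mapL (Ψ.psiCLM t)).sub h
  exact h1 (h1 h)

/-! ### The inverse (Bernstein) estimate -/

/-- The bump function whose dilates are the symbols of the operators `vp n`. -/
def outerBump (d : ℕ) : ContDiffBump (0 : EuclideanSpace ℝ (Fin d)) :=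
  ⟨d + 1, d + 2, by positivity, by linarith⟩

/-- Operators of de la Vallée Poussin type: they map to bandlimited elements and reproduce the
elements of bandwidth `2 ^ n`. -/
def vp (n : ℕ) (a : A) : A :=
  Ψ.fcalc (dilate (ρ := ((2 : ℝ) ^ n)⁻¹) (by positivity) (ofBump (outerBump d))) a

theorem outerBump_eq_one {n : ℕ} {x : EuclideanSpace ℝ (Fin d)} (hx : ‖x‖ ≤ (d + 1) * 2 ^ n) :
    outerBump d (((2 : ℝ) ^ n)⁻¹ • x) = 1 := by
  refine (outerBump d).one_of_mem_closedBall ?_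
  rw [mem_closedBall_zero_iff, norm_smul, norm_inv, norm_pow, Real.norm_ofNat, inv_mul_eq_div,
    div_le_iff₀ (by positivity)]
  exact hx

theorem outerBump_eq_zero {n : ℕ} {x : EuclideanSpace ℝ (Fin d)} (hx : (d + 2) * 2 ^ n ≤ ‖x‖) :
    outerBump d (((2 : ℝ) ^ n)⁻¹ • x) = 0 := by
  refine (outerBump d).zero_of_le_dist ?_
  rw [dist_zero_right, norm_smul, norm_inv, norm_pow, Real.norm_ofNat, inv_mul_eq_div,
    le_div_iff₀ (by positivity)]
  exact hx

theorem vp_sub (n : ℕ) {a b : A} (ha : a ∈ Ψ.contElements) (hb : b ∈ Ψ.contElements) :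
    Ψ.vp n (a - b) = Ψ.vp n a - Ψ.vp n b := Ψ.fcalc_sub _ ha hb

/-- The bound for the `w`-th derivative of `vp 0`. -/
def vpBound (w : List (Fin d)) : ℝ := Ψ.opBound * fourierL1 (wordMul w (ofBump (outerBump d)))

theorem vpBound_nonneg (w : List (Fin d)) : 0 ≤ Ψ.vpBound w :=
  mul_nonneg Ψ.opBound_pos.le (fourierL1_nonneg _)

/-- The constant in the bounds for the derivatives of the dyadic pieces. -/
def pieceBound (r : ℝ) (w : List (Fin d)) : ℝ :=
  2 ^ w.length * Ψ.vpBound w * ((1 + Ψ.vpBound []) * (1 + 2 ^ r))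

theorem pieceBound_nonneg (r : ℝ) (w : List (Fin d)) : 0 ≤ Ψ.pieceBound r w := by
  have h1 := Ψ.vpBound_nonneg w
  have h2 := Ψ.vpBound_nonneg []
  rw [pieceBound]
  positivity

/-- The dyadic pieces of an element. -/
def dyadicPiece (a : A) : ℕ → A
  | 0 => Ψ.vp 0 a
  | n + 1 => Ψ.vp (n + 1) a - Ψ.vp n a

theorem sum_dyadicPiece (a : A) (n : ℕ) :
    ∑ i ∈ Finset.range (n + 1), Ψ.dyadicPiece a i = Ψ.vp n a := by
  induction n with
  | zero => simp [dyadicPiece]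
  | succ n ih => rw [Finset.sum_range_succ, ih, dyadicPiece]; abel

/-- Elements that are approximable at some rate are continuous, since `C(A)` is closed. -/
theorem mem_contElements_of_approxError {r : ℝ} (hr : 0 < r) {a : A} {N : ℝ}
    (h : ∀ σ, Ψ.approxError σ a * ((σ : ℝ) + 1) ^ r ≤ N) : a ∈ Ψ.contElements := by
  rw [← Ψ.isClosed_contElements.closure_eq, Metric.mem_closure_iff]
  intro ε hε
  have h1 : Tendsto (fun n : ℕ => N * ((n : ℝ) + 1) ^ (-r)) atTop (𝓝 0) := by
    have h2 : Tendsto (fun n : ℕ => (n : ℝ) + 1) atTop atTop :=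
      tendsto_atTop_add_const_right _ _ tendsto_natCast_atTop_atTop
    simpa using ((tendsto_rpow_neg_atTop hr).comp h2).const_mul N
  obtain ⟨n, hn⟩ := (h1.eventually_lt_const hε).exists
  have h3 : Ψ.approxError n a < ε := by
    refine lt_of_le_of_lt ?_ hn
    rw [Real.rpow_neg (by positivity), ← div_eq_mul_inv, le_div_iff₀ (by positivity)]
    exact_mod_cast h n
  have : Nonempty (Ψ.bandlimited n) := ⟨⟨0, Ψ.zero_mem_bandlimited _⟩⟩
  obtain ⟨⟨x, hx⟩, hxa⟩ := exists_lt_of_ciInf_lt h3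
  exact ⟨x, Ψ.bandlimited_subset_contElements _ hx, by rwa [dist_eq_norm]⟩

theorem approxError_two_pow_le {r : ℝ} (hr : 0 < r) {a : A} {N : ℝ}
    (h : ∀ σ, Ψ.approxError σ a * ((σ : ℝ) + 1) ^ r ≤ N) (n : ℕ) :
    Ψ.approxError (2 ^ n) a ≤ N * ((2 : ℝ) ^ (-r)) ^ n := by
  have h1 := h (2 ^ n)
  have h2 : ((2 : ℝ) ^ (-r)) ^ n = (((2 : ℝ) ^ n) ^ r)⁻¹ := by
    rw [← Real.rpow_natCast, ← Real.rpow_mul zero_le_two, mul_comm, Real.rpow_mul zero_le_two,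
      Real.rpow_natCast, Real.rpow_neg (by positivity)]
  rw [h2, ← div_eq_mul_inv, le_div_iff₀ (by positivity)]
  refine le_trans ?_ h1
  push_cast
  have := Ψ.approxError_nonneg (2 ^ n) a
  gcongr
  linarith

variable [CompleteSpace A]

/-- Termwise differentiation of series. -/
theorem mem_smoothElements_of_hasSum {k : ℕ} {c : ℕ → A} {a : A}
    (hc : ∀ n, c n ∈ Ψ.smoothElements k)
    (hs : ∀ w : List (Fin d), w.length ≤ k → Summable fun n => ‖Ψ.iterGen w (c n)‖)
    (ha : HasSum c a) :
    a ∈ Ψ.smoothElements k ∧ ∀ w : List (Fin d), w.length ≤ k →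
      HasSum (fun n => Ψ.iterGen w (c n)) (Ψ.iterGen w a) := by
  have hac : a ∈ Ψ.contElements :=
    Ψ.isClosed_contElements.mem_of_tendsto ha (Eventually.of_forall fun s =>
      Ψ.contSubmodule.sum_mem fun n _ => Ψ.smoothElements_subset_contElements k (hc n))
  induction k generalizing c a with
  | zero =>
    refine ⟨Ψ.mem_smoothElements_zero.2 hac, fun w hw => ?_⟩
    have : w = [] := by simpa using hw
    rw [this]
    exact ha
  | succ k ih =>
    have h1 : ∀ j, a ∈ Ψ.canDomain j ∧ HasSum (fun n => Ψ.canGen j (c n)) (Ψ.canGen j a) := by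
      intro j
      have hsj : Summable fun n => ‖Ψ.canGen j (c n)‖ := hs [j] (by simp)
      have h2 := hasDerivAt_tsum (hsj.mul_left Ψ.opBound)
        (g := fun n (s : ℝ) => Ψ.psi (s • EuclideanSpace.single j 1) (c n))
        (fun n s => Ψ.hasDerivAt_orbit ((Ψ.mem_smoothElements_succ.1 (hc n)).2 j).1 s)
        (fun n s => Ψ.norm_psi_le _ _) (y₀ := 0) (by simpa using ha.summable) 0
      simp only [zero_smul, psi_zero] at h2
      have h3 : ∀ s : ℝ, ∑' n, Ψ.psi (s • EuclideanSpace.single j 1) (c n) =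
          Ψ.psi (s • EuclideanSpace.single j 1) a := fun s =>
        (ha.mapL (Ψ.psiCLM (s • EuclideanSpace.single j 1))).tsum_eq
      simp only [h3] at h2
      refine ⟨Ψ.mem_canDomain_of_hasDerivAt h2, ?_⟩
      rw [Ψ.canGen_eq_of_hasDerivAt h2]
      exact hsj.of_norm.hasSum
    have h2 : ∀ j, _ := fun j => ih (c := fun n => Ψ.canGen j (c n)) (a := Ψ.canGen j a)
      (fun n => ((Ψ.mem_smoothElements_succ.1 (hc n)).2 j).2)
      (fun w hw => hs (j :: w) (by simpa using hw)) (h1 j).2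
      (Ψ.isClosed_contElements.mem_of_tendsto (h1 j).2 (Eventually.of_forall fun s =>
        Ψ.contSubmodule.sum_mem fun n _ => Ψ.smoothElements_subset_contElements k
          ((Ψ.mem_smoothElements_succ.1 (hc n)).2 j).2))
    refine ⟨Ψ.mem_smoothElements_succ.2 ⟨hac, fun j => ⟨(h1 j).1, (h2 j).1⟩⟩, fun w hw => ?_⟩
    cases w with
    | nil => exact ha
    | cons j w => exact (h2 j).2 w (by simpa using hw)

theorem vp_eq_self {n : ℕ} {a : A} (ha : a ∈ Ψ.bandlimited (2 ^ n)) : Ψ.vp n a = a := by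
  refine Ψ.fcalc_eq_self (s := Metric.ball 0 ((d + 1) * 2 ^ n)) (by positivity) ha
    Metric.isOpen_ball (fun x hx => ?_) fun x hx => ?_
  · rw [mem_ball_zero_iff]
    refine (norm_le_of_mem_cube hx).trans_lt ?_
    push_cast
    gcongr
    linarith
  · rw [dilate_apply, ofBump_apply, outerBump_eq_one (mem_ball_zero_iff.1 hx).le]
    simp

theorem vp_mem_contElements (n : ℕ) {a : A} (ha : a ∈ Ψ.contElements) :
    Ψ.vp n a ∈ Ψ.contElements := Ψ.fcalc_mem_contElements _ ha

/-- The symbol of `vp m` is `1` on the support of the symbol of `vp n`. -/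
theorem vp_vp {m n : ℕ} (h : n < m) {a : A} (ha : a ∈ Ψ.contElements) :
    Ψ.vp m (Ψ.vp n a) = Ψ.vp n a := by
  rw [vp, vp, Ψ.fcalc_fcalc _ _ ha]
  congr 1
  ext x
  rw [mulSchwartz_apply, dilate_apply, dilate_apply, ofBump_apply, ofBump_apply]
  rcases le_total (((d : ℝ) + 2) * 2 ^ n) ‖x‖ with hx | hx
  · rw [outerBump_eq_zero hx]; simp
  · rw [outerBump_eq_one (n := m)]
    · simp
    · refine hx.trans ?_
      have h1 : (2 : ℝ) ^ (n + 1) ≤ 2 ^ m := pow_le_pow_right₀ one_le_two h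
      have h2 : (0 : ℝ) < 2 ^ n := by positivity
      rw [pow_succ] at h1
      have hd : (0 : ℝ) ≤ d := by positivity
      calc ((d : ℝ) + 2) * 2 ^ n ≤ (d + 1) * (2 ^ n * 2) := by nlinarith
        _ ≤ _ := by gcongr

theorem norm_iterGen_vp_le (w : List (Fin d)) (n : ℕ) {a : A} (ha : a ∈ Ψ.contElements) :
    ‖Ψ.iterGen w (Ψ.vp n a)‖ ≤ (2 ^ n) ^ w.length * (Ψ.vpBound w * ‖a‖) := by
  have h := Ψ.norm_iterGen_fcalc_dilate_le w (ρ := ((2 : ℝ) ^ n)⁻¹) (by positivity)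
    (ofBump (outerBump d)) ha
  rw [inv_inv] at h
  exact h

/-- `vp n` is a near-best approximation, as it is bounded and reproduces bandlimited elements. -/
theorem norm_sub_vp_le (n : ℕ) {a : A} (ha : a ∈ Ψ.contElements) :
    ‖a - Ψ.vp n a‖ ≤ (1 + Ψ.vpBound []) * Ψ.approxError (2 ^ n) a := by
  have hK := Ψ.vpBound_nonneg []
  refine Ψ.le_mul_approxError (fun x hx => ?_) (by positivity)
  have hxc := Ψ.bandlimited_subset_contElements _ hx
  have hax : a - x ∈ Ψ.contElements := Ψ.contSubmodule.sub_mem ha hxc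
  have h1 : a - Ψ.vp n a = (a - x) - Ψ.vp n (a - x) := by
    rw [Ψ.vp_sub n ha hxc, Ψ.vp_eq_self hx]; abel
  have h2 := Ψ.norm_iterGen_vp_le [] n hax
  simp only [iterGen_nil, List.length_nil, pow_zero, one_mul] at h2
  rw [h1, add_mul, one_mul]
  exact (norm_sub_le _ _).trans (by gcongr)

theorem dyadicPiece_mem_contElements {a : A} (ha : a ∈ Ψ.contElements) (n : ℕ) :
    Ψ.dyadicPiece a n ∈ Ψ.contElements := by
  cases n with
  | zero => exact Ψ.vp_mem_contElements 0 ha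
  | succ n =>
    exact Ψ.contSubmodule.sub_mem (Ψ.vp_mem_contElements _ ha) (Ψ.vp_mem_contElements _ ha)

theorem vp_dyadicPiece {a : A} (ha : a ∈ Ψ.contElements) (n : ℕ) :
    Ψ.vp (n + 1) (Ψ.dyadicPiece a n) = Ψ.dyadicPiece a n := by
  cases n with
  | zero => exact Ψ.vp_vp (by omega) ha
  | succ n =>
    rw [dyadicPiece, Ψ.vp_sub _ (Ψ.vp_mem_contElements _ ha) (Ψ.vp_mem_contElements _ ha),
      Ψ.vp_vp (by omega) ha, Ψ.vp_vp (by omega) ha]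

theorem norm_dyadicPiece_le {r : ℝ} (hr : 0 < r) {a : A} {N : ℝ} (hN : 0 ≤ N)
    (h : ∀ σ, Ψ.approxError σ a * ((σ : ℝ) + 1) ^ r ≤ N) (n : ℕ) :
    ‖Ψ.dyadicPiece a n‖ ≤ (1 + Ψ.vpBound []) * (1 + 2 ^ r) * N * ((2 : ℝ) ^ (-r)) ^ n := by
  have ha := Ψ.mem_contElements_of_approxError hr h
  have hK := Ψ.vpBound_nonneg []
  cases n with
  | zero =>
    have h1 := Ψ.norm_iterGen_vp_le [] 0 ha
    simp only [iterGen_nil, List.length_nil, pow_zero, one_mul] at h1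
    have h2 : ‖a‖ ≤ N := by
      have := h 0
      simpa [approxError_zero] using this
    rw [pow_zero, mul_one]
    calc ‖Ψ.vp 0 a‖ ≤ Ψ.vpBound [] * N := h1.trans (by gcongr)
      _ ≤ (1 + Ψ.vpBound []) * (1 + 0) * N := by gcongr; linarith
      _ ≤ _ := by gcongr; positivity
  | succ n =>
    have h1 : Ψ.dyadicPiece a (n + 1) = (a - Ψ.vp n a) - (a - Ψ.vp (n + 1) a) := by
      rw [dyadicPiece]; abel
    have h2 := fun n => (Ψ.norm_sub_vp_le n ha).trans
      (mul_le_mul_of_nonneg_left (Ψ.approxError_two_pow_le hr h n) (by positivity))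
    have h3 : (2 : ℝ) ^ r * 2 ^ (-r) = 1 := by
      rw [← Real.rpow_add two_pos]; simp
    rw [h1]
    refine (norm_sub_le _ _).trans ((add_le_add (h2 n) (h2 (n + 1))).trans_eq ?_)
    rw [pow_succ]
    linear_combination -((1 + Ψ.vpBound []) * N * ((2 : ℝ) ^ (-r)) ^ n) * h3

theorem hasSum_dyadicPiece {r : ℝ} (hr : 0 < r) {a : A} {N : ℝ} (hN : 0 ≤ N)
    (h : ∀ σ, Ψ.approxError σ a * ((σ : ℝ) + 1) ^ r ≤ N) : HasSum (Ψ.dyadicPiece a) a := by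
  have ha := Ψ.mem_contElements_of_approxError hr h
  have hK := Ψ.vpBound_nonneg []
  have hq : (2 : ℝ) ^ (-r) < 1 := Real.rpow_lt_one_of_one_lt_of_neg one_lt_two (by linarith)
  have hq0 : (0 : ℝ) ≤ (2 : ℝ) ^ (-r) := by positivity
  have h1 : Summable (Ψ.dyadicPiece a) :=
    Summable.of_norm_bounded ((summable_geometric_of_lt_one hq0 hq).mul_left _)
      (Ψ.norm_dyadicPiece_le hr hN h)
  have h2 : Tendsto (fun n => Ψ.vp n a) atTop (𝓝 a) := by
    rw [tendsto_iff_norm_sub_tendsto_zero]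
    refine squeeze_zero (fun _ => norm_nonneg _) (fun n => ?_)
      (g := fun n => (1 + Ψ.vpBound []) * (N * ((2 : ℝ) ^ (-r)) ^ n)) ?_
    · rw [norm_sub_rev]
      exact (Ψ.norm_sub_vp_le n ha).trans
        (mul_le_mul_of_nonneg_left (Ψ.approxError_two_pow_le hr h n) (by positivity))
    · simpa using ((tendsto_pow_atTop_nhds_zero_of_lt_one hq0 hq).const_mul N).const_mul
        (1 + Ψ.vpBound [])
  have h3 := (tendsto_add_atTop_iff_nat 1).2 h1.hasSum.tendsto_sum_nat
  simp only [sum_dyadicPiece] at h3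
  have h4 := h1.hasSum
  rwa [tendsto_nhds_unique h3 h2] at h4

theorem dyadicPiece_mem_smoothElements {a : A} (ha : a ∈ Ψ.contElements) (k n : ℕ) :
    Ψ.dyadicPiece a n ∈ Ψ.smoothElements k := by
  rw [← Ψ.vp_dyadicPiece ha]
  exact Ψ.fcalc_mem_smoothElements k _ (Ψ.dyadicPiece_mem_contElements ha n)

/-- Bernstein's inequality for the dyadic pieces. -/
theorem norm_iterGen_dyadicPiece_le {r : ℝ} (hr : 0 < r) {a : A} {N : ℝ} (hN : 0 ≤ N)
    (h : ∀ σ, Ψ.approxError σ a * ((σ : ℝ) + 1) ^ r ≤ N) (w : List (Fin d)) (n : ℕ) :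
    ‖Ψ.iterGen w (Ψ.dyadicPiece a n)‖ ≤
      Ψ.pieceBound r w * N * ((2 : ℝ) ^ ((w.length : ℝ) - r)) ^ n := by
  have ha := Ψ.mem_contElements_of_approxError hr h
  have hK := Ψ.vpBound_nonneg w
  rw [← Ψ.vp_dyadicPiece ha]
  refine (Ψ.norm_iterGen_vp_le w _ (Ψ.dyadicPiece_mem_contElements ha n)).trans ?_
  calc _ ≤ (2 ^ (n + 1)) ^ w.length * (Ψ.vpBound w *
        ((1 + Ψ.vpBound []) * (1 + 2 ^ r) * N * ((2 : ℝ) ^ (-r)) ^ n)) := by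
        gcongr
        exact Ψ.norm_dyadicPiece_le hr hN h n
    _ = _ := by
        rw [pieceBound, sub_eq_add_neg, Real.rpow_add two_pos, Real.rpow_natCast, mul_pow,
          ← pow_mul, ← pow_mul (2 : ℝ) w.length, add_mul, pow_add, one_mul, mul_comm n]
        ring

/-- The inverse estimate: the rate of approximation `N (σ + 1) ^ (-(k + η))` controls the
derivatives up to order `k` and the second differences of those of order `k`. -/
theorem exists_inverse_estimate (k : ℕ) {η : ℝ} (hη : 0 < η) (hη1 : η ≤ 1) :
    ∃ C : List (Fin d) → ℝ, (∀ w, 0 ≤ C w) ∧ ∀ (a : A) (N : ℝ), 0 ≤ N →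
      (∀ σ, Ψ.approxError σ a * ((σ : ℝ) + 1) ^ (k + η) ≤ N) →
      a ∈ Ψ.smoothElements k ∧
      (∀ w : List (Fin d), w.length ≤ k → ‖Ψ.iterGen w a‖ ≤ C w * N) ∧
      ∀ w : List (Fin d), w.length = k → ∀ t : EuclideanSpace ℝ (Fin d), t ≠ 0 →
        ‖(Ψ.diff t)^[2] (Ψ.iterGen w a)‖ ≤ C w * N * (∑ j, |t j|) ^ η := by
  set r : ℝ := k + η with hr_def
  have hr : 0 < r := by positivity
  have hM := Ψ.opBound_pos
  obtain ⟨C₀, hC₀, hC⟩ := exists_tsum_le_rpow hη hη1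
  set q : List (Fin d) → ℝ := fun w => (2 : ℝ) ^ ((w.length : ℝ) - r) with hq
  have hq0 : ∀ w, 0 ≤ q w := fun w => by positivity
  have hq1 : ∀ w : List (Fin d), w.length ≤ k → q w < 1 := fun w hw => by
    refine Real.rpow_lt_one_of_one_lt_of_neg one_lt_two ?_
    have : (w.length : ℝ) ≤ k := by exact_mod_cast hw
    linarith
  -- The two summands come from the trivial bound for second differences and from the bound by
  -- second derivatives.
  set D : List (Fin d) → ℝ := fun w => (Ψ.opBound + 1) ^ 2 * Ψ.pieceBound r w +
    Ψ.opBound ^ 4 * ∑ i, ∑ j, Ψ.pieceBound r (w ++ [i, j]) with hD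
  have hP := Ψ.pieceBound_nonneg r
  have hD0 : ∀ w, 0 ≤ D w := fun w => by
    have : 0 ≤ ∑ i, ∑ j, Ψ.pieceBound r (w ++ [i, j]) :=
      Finset.sum_nonneg fun _ _ => Finset.sum_nonneg fun _ _ => hP _
    have := hP w
    positivity
  refine ⟨fun w => max (Ψ.pieceBound r w * (1 - q w)⁻¹) (D w * C₀), fun w =>
    le_max_of_le_right (mul_nonneg (hD0 w) hC₀), fun a N hN h => ?_⟩
  have ha := Ψ.mem_contElements_of_approxError hr h
  have hbd := Ψ.norm_iterGen_dyadicPiece_le hr hN h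
  obtain ⟨hak, hsum⟩ := Ψ.mem_smoothElements_of_hasSum
    (Ψ.dyadicPiece_mem_smoothElements ha k)
    (fun w hw => Summable.of_nonneg_of_le (fun _ => norm_nonneg _) (hbd w)
      ((summable_geometric_of_lt_one (hq0 w) (hq1 w hw)).mul_left _))
    (Ψ.hasSum_dyadicPiece hr hN h)
  refine ⟨hak, fun w hw => ?_, fun w hw t ht => ?_⟩
  · have h1 := (hasSum_geometric_of_lt_one (hq0 w) (hq1 w hw)).mul_left (Ψ.pieceBound r w * N)
    calc ‖Ψ.iterGen w a‖ ≤ Ψ.pieceBound r w * N * (1 - q w)⁻¹ := by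
          rw [← (hsum w hw).tsum_eq]
          exact tsum_of_norm_bounded h1 (hbd w)
      _ = Ψ.pieceBound r w * (1 - q w)⁻¹ * N := by ring
      _ ≤ _ := by gcongr; exact le_max_left _ _
  · set S := ∑ j, |t j| with hS
    have hS0 : 0 < S := sum_abs_pos ht
    have hqw : q w = 2 ^ (-η) := by rw [hq]; simp only [hw, hr_def]; congr 1; ring
    have hqw2 : ∀ i j, q (w ++ [i, j]) = 4 * 2 ^ (-η) := fun i j => by
      rw [hq]
      simp only [List.length_append, hw, hr_def, List.length_cons, List.length_nil]
      have : ((k + (0 + 1 + 1) : ℕ) : ℝ) - (k + η) = 2 + -η := by push_cast; ring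
      rw [this, Real.rpow_add two_pos]
      norm_num
    have hb1 : ∀ n, ‖(Ψ.diff t)^[2] (Ψ.iterGen w (Ψ.dyadicPiece a n))‖ ≤
        D w * N * ((2 : ℝ) ^ (-η)) ^ n := fun n => by
      have h0 : 0 ≤ ∑ i, ∑ j, Ψ.pieceBound r (w ++ [i, j]) :=
        Finset.sum_nonneg fun _ _ => Finset.sum_nonneg fun _ _ => hP _
      refine (Ψ.norm_diff_diff_le t _).trans ?_
      calc _ ≤ (Ψ.opBound + 1) ^ 2 * (Ψ.pieceBound r w * N * q w ^ n) := by
            gcongr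
            exact hbd w n
        _ = (Ψ.opBound + 1) ^ 2 * Ψ.pieceBound r w * N * ((2 : ℝ) ^ (-η)) ^ n := by
            rw [hqw]; ring
        _ ≤ _ := by
            gcongr
            exact le_add_of_nonneg_right (by positivity)
    have hb2 : ∀ n, ‖(Ψ.diff t)^[2] (Ψ.iterGen w (Ψ.dyadicPiece a n))‖ ≤
        D w * N * (S ^ 2 * (4 * (2 : ℝ) ^ (-η)) ^ n) := fun n => by
      refine (Ψ.norm_diff_diff_le_of_canGen (Ψ.iterGen_mem_smoothElements
        (Ψ.dyadicPiece_mem_smoothElements ha _ n))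
        (B := (∑ i, ∑ j, Ψ.pieceBound r (w ++ [i, j])) * N * (4 * (2 : ℝ) ^ (-η)) ^ n)
        (fun i j => ?_) t).trans ?_
      · have h1 := hbd (w ++ [i, j]) n
        rw [iterGen_append] at h1
        refine h1.trans ?_
        change _ * q (w ++ [i, j]) ^ n ≤ _
        rw [hqw2]
        gcongr
        exact (Finset.single_le_sum (f := fun j => Ψ.pieceBound r (w ++ [i, j]))
          (fun _ _ => hP _) (Finset.mem_univ j)).trans
          (Finset.single_le_sum (f := fun i => ∑ j, Ψ.pieceBound r (w ++ [i, j]))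
          (fun _ _ => Finset.sum_nonneg fun _ _ => hP _) (Finset.mem_univ i))
      · calc _ = Ψ.opBound ^ 4 * (∑ i, ∑ j, Ψ.pieceBound r (w ++ [i, j])) * N *
              (S ^ 2 * (4 * (2 : ℝ) ^ (-η)) ^ n) := by rw [← hS]; ring
          _ ≤ _ := by
            gcongr
            exact le_add_of_nonneg_left (mul_nonneg (by positivity) (hP w))
    have hsw := Ψ.hasSum_diff_diff (hsum w hw.le) t
    have hmain : ‖(Ψ.diff t)^[2] (Ψ.iterGen w a)‖ ≤ D w * N * (C₀ * S ^ η) := by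
      rcases (mul_nonneg (hD0 w) hN).eq_or_lt with h0 | h0
      · have h1 : ∀ n, (Ψ.diff t)^[2] (Ψ.iterGen w (Ψ.dyadicPiece a n)) = 0 := fun n => by
          have := hb1 n
          rw [← h0, zero_mul] at this
          exact norm_le_zero_iff.1 this
        simp only [h1] at hsw
        rw [← hasSum_zero.unique hsw, ← h0]
        simp
      · obtain ⟨h1, h2⟩ := hC S hS0
          (fun n => (D w * N)⁻¹ * ‖(Ψ.diff t)^[2] (Ψ.iterGen w (Ψ.dyadicPiece a n))‖)
          (fun n => by positivity)
          (fun n => (inv_mul_le_iff₀ h0).2 (hb1 n)) (fun n => (inv_mul_le_iff₀ h0).2 (hb2 n))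
        rw [tsum_mul_left, inv_mul_le_iff₀ h0] at h2
        have h3 : Summable fun n => ‖(Ψ.diff t)^[2] (Ψ.iterGen w (Ψ.dyadicPiece a n))‖ :=
          (summable_mul_left_iff (inv_ne_zero h0.ne')).1 h1
        rw [← hsw.tsum_eq]
        exact (norm_tsum_le_tsum_norm h3).trans h2
    calc _ ≤ D w * C₀ * N * S ^ η := hmain.trans_eq (by ring)
      _ ≤ _ := by gcongr; exact le_max_right _ _

end

section

/-! ### The norms of the two scales of spaces -/

theorem approxNorm_le_ofReal {r N : ℝ} {a : A}
    (h : ∀ σ, Ψ.approxError σ a * ((σ : ℝ) + 1) ^ r ≤ N) :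
    Ψ.approxNorm r a ≤ ENNReal.ofReal N :=
  iSup_le fun σ => ENNReal.ofReal_le_ofReal (h σ)

theorem approxError_mul_le_toReal {r : ℝ} {a : A} (h : Ψ.approxNorm r a ≠ ∞) (σ : ℝ≥0) :
    Ψ.approxError σ a * ((σ : ℝ) + 1) ^ r ≤ (Ψ.approxNorm r a).toReal :=
  (ENNReal.ofReal_le_iff_le_toReal h).1
    (le_iSup (fun σ : ℝ≥0 => ENNReal.ofReal (Ψ.approxError σ a * ((σ : ℝ) + 1) ^ r)) σ)

/-- The weights `(σ + 1) ^ r` and `σ ^ r` are equivalent for `σ ≥ 1`, and for `σ ≤ 1` the error is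
at most the norm. -/
theorem approxError_mul_le {r K N : ℝ} (hr : 0 < r) (hK : 0 ≤ K) (hN : 0 ≤ N) {a : A}
    (ha : ‖a‖ ≤ N) (h : ∀ σ : ℝ≥0, 0 < σ → Ψ.approxError σ a ≤ K * (σ : ℝ) ^ (-r) * N) (σ : ℝ≥0) :
    Ψ.approxError σ a * ((σ : ℝ) + 1) ^ r ≤ 2 ^ r * (1 + K) * N := by
  rcases le_total (σ : ℝ) 1 with h1 | h1
  · calc _ ≤ N * 2 ^ r := by
          gcongr
          · exact (Ψ.approxError_le_norm σ a).trans ha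
          · linarith
      _ = 2 ^ r * (1 + 0) * N := by ring
      _ ≤ _ := by gcongr
  · have h0 : (0 : ℝ) < σ := by linarith
    calc _ ≤ K * (σ : ℝ) ^ (-r) * N * (2 * σ) ^ r := by
          gcongr
          · exact h σ h0
          · linarith
      _ = 2 ^ r * (0 + K) * N := by
          rw [Real.mul_rpow zero_le_two h0.le, Real.rpow_neg h0.le]
          field_simp
          ring
      _ ≤ _ := by gcongr; exact zero_le_one

theorem approxNorm_lt_top_iff {r : ℝ} (hr : 0 < r) (a : A) :
    Ψ.approxNorm r a < ∞ ↔
      ∃ C : ℝ, ∀ σ : ℝ≥0, 0 < σ → Ψ.approxError σ a ≤ C * (σ : ℝ) ^ (-r) := by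
  refine ⟨fun h => ⟨(Ψ.approxNorm r a).toReal, fun σ hσ => ?_⟩, fun ⟨C, hC⟩ => ?_⟩
  · have hσ' : (0 : ℝ) < σ := hσ
    rw [Real.rpow_neg hσ'.le, ← div_eq_mul_inv, le_div_iff₀ (by positivity)]
    refine le_trans ?_ (Ψ.approxError_mul_le_toReal h.ne σ)
    have := Ψ.approxError_nonneg σ a
    gcongr
    linarith
  · refine (Ψ.approxNorm_le_ofReal (Ψ.approxError_mul_le (K := |C|) (N := ‖a‖ + 1) hr
      (abs_nonneg C) (by positivity) (by linarith) fun σ hσ => (hC σ hσ).trans ?_)).trans_lt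
      ENNReal.ofReal_lt_top
    calc C * (σ : ℝ) ^ (-r) ≤ |C| * (σ : ℝ) ^ (-r) * 1 := by
          rw [mul_one]; gcongr; exact le_abs_self C
      _ ≤ _ := by gcongr; linarith [norm_nonneg a]

theorem norm_le_smoothNorm (k : ℕ) (a : A) : ‖a‖ ≤ Ψ.smoothNorm k a := by
  have h0 : ∀ (m : ℕ) (α : Fin d → ℕ), 0 ≤ (∏ j, ((α j)! : ℝ))⁻¹ * ‖Ψ.multiGen α a‖ :=
    fun m α => by positivity
  have h1 : Ψ.multiGen (0 : Fin d → ℕ) a = a := by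
    have : multiWord (0 : Fin d → ℕ) = [] := by
      rw [← List.length_eq_zero_iff, length_multiWord]
      simp
    rw [multiGen_eq_iterGen, this, iterGen_nil]
  refine le_trans ?_ (Finset.single_le_sum (f := fun m => ∑ α ∈ Finset.piAntidiag
    (Finset.univ : Finset (Fin d)) m, (∏ j, ((α j)! : ℝ))⁻¹ * ‖Ψ.multiGen α a‖)
    (fun m _ => Finset.sum_nonneg fun α _ => h0 m α) (Finset.mem_range.2 (Nat.succ_pos k)))
  refine le_trans ?_ (Finset.single_le_sum
    (f := fun α : Fin d → ℕ => (∏ j, ((α j)! : ℝ))⁻¹ * ‖Ψ.multiGen α a‖)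
    (fun α _ => h0 0 α) (Finset.mem_piAntidiag.2 ⟨?_, fun i _ => Finset.mem_univ i⟩ :
      (0 : Fin d → ℕ) ∈ _))
  · simp [h1]
  · simp

theorem norm_diff_diff_le_of_zygmundSeminorm_le {η N : ℝ} (hN : 0 ≤ N) {a : A}
    (h : Ψ.zygmundSeminorm η a ≤ ENNReal.ofReal N) (t : EuclideanSpace ℝ (Fin d)) :
    ‖(Ψ.diff t)^[2] a‖ ≤ N * (∑ j, |t j|) ^ η := by
  have hS0 : 0 ≤ ∑ j, |t j| := Finset.sum_nonneg fun _ _ => abs_nonneg _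
  by_cases ht : t = 0
  · have h0 : ∀ b, Ψ.diff 0 b = 0 := fun b => by simp [diff]
    rw [ht]
    simp only [Function.iterate_succ, Function.comp_apply, h0, Function.iterate_zero, id,
      norm_zero]
    positivity
  · have h1 := (le_iSup₂ (f := fun (t : EuclideanSpace ℝ (Fin d)) (_ : t ≠ 0) =>
      ENNReal.ofReal ((∑ j, |t j|) ^ (-η) * ‖(Ψ.diff t)^[2] a‖)) t ht).trans h
    rw [ENNReal.ofReal_le_ofReal_iff hN] at h1
    have hS : 0 < ∑ j, |t j| := sum_abs_pos ht
    rwa [Real.rpow_neg hS0, inv_mul_le_iff₀ (by positivity), mul_comm] at h1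

theorem zygmundSeminorm_le_ofReal {η N : ℝ} {a : A}
    (h : ∀ t : EuclideanSpace ℝ (Fin d), t ≠ 0 → ‖(Ψ.diff t)^[2] a‖ ≤ N * (∑ j, |t j|) ^ η) :
    Ψ.zygmundSeminorm η a ≤ ENNReal.ofReal N := by
  refine iSup₂_le fun t ht => ENNReal.ofReal_le_ofReal ?_
  have hS0 : 0 ≤ ∑ j, |t j| := Finset.sum_nonneg fun _ _ => abs_nonneg _
  have hS : 0 < ∑ j, |t j| := sum_abs_pos ht
  rw [Real.rpow_neg hS0, inv_mul_le_iff₀ (by positivity), mul_comm]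
  exact h t ht

theorem holderNorm_of_mem {r : ℝ} {a : A} (ha : a ∈ Ψ.smoothElements (⌈r⌉₊ - 1)) :
    Ψ.holderNorm r a = ENNReal.ofReal (Ψ.smoothNorm (⌈r⌉₊ - 1) a) +
      ∑ α ∈ Finset.piAntidiag (Finset.univ : Finset (Fin d)) (⌈r⌉₊ - 1),
        Ψ.zygmundSeminorm (r - (⌈r⌉₊ - 1 : ℕ)) (Ψ.multiGen α a) := if_pos ha

theorem holderNorm_of_notMem {r : ℝ} {a : A} (ha : a ∉ Ψ.smoothElements (⌈r⌉₊ - 1)) :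
    Ψ.holderNorm r a = ∞ := if_neg ha

/-- In the decomposition `r = k + η` with `k = ⌈r⌉ - 1`, one has `0 < η ≤ 1`. -/
theorem holderNorm_exponents {r : ℝ} (hr : 0 < r) :
    0 < r - (⌈r⌉₊ - 1 : ℕ) ∧ r - (⌈r⌉₊ - 1 : ℕ) ≤ 1 := by
  have h1 : 0 < ⌈r⌉₊ := Nat.ceil_pos.2 hr
  refine ⟨sub_pos.2 (Nat.lt_ceil.1 (by omega)), ?_⟩
  have h2 := Nat.le_ceil r
  rw [Nat.cast_sub h1]
  push_cast
  linarith

variable [CompleteSpace A]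

/-- Jackson's theorem: smoothness gives a rate of approximation. -/
theorem exists_approxNorm_le {r : ℝ} (hr : 0 < r) :
    ∃ C : ℝ≥0, ∀ a : A, Ψ.approxNorm r a ≤ C * Ψ.holderNorm r a := by
  obtain ⟨hη, hη1⟩ := holderNorm_exponents hr
  set k := ⌈r⌉₊ - 1 with hk
  set K := (Ψ.opBound ^ 2 * fourierMoment (ofBump (innerBump d))) ^ (k + 1) with hKdef
  have hK : 0 ≤ K := by
    have := fourierMoment_nonneg (ofBump (innerBump d))
    positivity
  refine ⟨Real.toNNReal (2 ^ r * (1 + K)), fun a => ?_⟩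
  by_cases hfin : Ψ.holderNorm r a = ∞
  · rw [hfin, ENNReal.mul_top]
    · exact le_top
    · simpa using (by positivity : 0 < (2 : ℝ) ^ r * (1 + K))
  have hak : a ∈ Ψ.smoothElements k := by
    by_contra h
    exact hfin (Ψ.holderNorm_of_notMem h)
  have hdef := Ψ.holderNorm_of_mem hak
  set N := (Ψ.holderNorm r a).toReal with hN
  have hN0 : 0 ≤ N := ENNReal.toReal_nonneg
  have hNof : ENNReal.ofReal N = Ψ.holderNorm r a := ENNReal.ofReal_toReal hfin
  have ha : ‖a‖ ≤ N := by
    refine (Ψ.norm_le_smoothNorm k a).trans ((ENNReal.ofReal_le_iff_le_toReal hfin).1 ?_)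
    rw [hdef]
    exact le_self_add
  have hz : ∀ w : List (Fin d), w.length = k →
      ∀ t, ‖(Ψ.diff t)^[2] (Ψ.iterGen w a)‖ ≤ N * (∑ j, |t j|) ^ (r - k) := by
    intro w hw
    refine Ψ.norm_diff_diff_le_of_zygmundSeminorm_le hN0 ?_
    rw [Ψ.iterGen_eq_multiGen w (hw ▸ hak), hNof, hdef]
    refine le_add_left (Finset.single_le_sum
      (f := fun α => Ψ.zygmundSeminorm (r - k) (Ψ.multiGen α a)) (fun _ _ => zero_le)
      (Finset.mem_piAntidiag.2 ⟨?_, fun i _ => Finset.mem_univ i⟩))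
    have h1 := (perm_multiWord_count w).length_eq
    rw [length_multiWord, hw] at h1
    exact h1.symm
  have h1 := Ψ.approxNorm_le_ofReal (Ψ.approxError_mul_le hr hK hN0 ha fun σ hσ => by
    have := Ψ.approxError_le_of_diff hσ hη hη1 hN0 k hak hz
    rwa [add_sub_cancel] at this)
  rw [ENNReal.ofReal_mul (by positivity), hNof] at h1
  exact h1

/-- Bernstein's theorem: a rate of approximation gives smoothness. -/
theorem exists_holderNorm_le {r : ℝ} (hr : 0 < r) :
    ∃ C : ℝ≥0, ∀ a : A, Ψ.holderNorm r a ≤ C * Ψ.approxNorm r a := by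
  obtain ⟨hη, hη1⟩ := holderNorm_exponents hr
  set k := ⌈r⌉₊ - 1 with hk
  obtain ⟨C, hC0, hC⟩ := Ψ.exists_inverse_estimate k hη hη1
  rw [add_sub_cancel] at hC
  set c₁ : ℝ := ∑ m ∈ Finset.range (k + 1),
    ∑ α ∈ Finset.piAntidiag (Finset.univ : Finset (Fin d)) m,
      (∏ j, ((α j)! : ℝ))⁻¹ * C (multiWord α) with hc₁
  set c₂ : ℝ := ∑ α ∈ Finset.piAntidiag (Finset.univ : Finset (Fin d)) k, C (multiWord α)
    with hc₂
  have hc₁0 : 0 ≤ c₁ := Finset.sum_nonneg fun _ _ => Finset.sum_nonneg fun α _ =>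
    mul_nonneg (by positivity) (hC0 _)
  have hc₂0 : 0 ≤ c₂ := Finset.sum_nonneg fun _ _ => hC0 _
  refine ⟨Real.toNNReal (1 + c₁ + c₂), fun a => ?_⟩
  by_cases hfin : Ψ.approxNorm r a = ∞
  · rw [hfin, ENNReal.mul_top]
    · exact le_top
    · simpa using (by positivity : 0 < 1 + c₁ + c₂)
  set N := (Ψ.approxNorm r a).toReal with hN
  have hN0 : 0 ≤ N := ENNReal.toReal_nonneg
  have hNof : ENNReal.ofReal N = Ψ.approxNorm r a := ENNReal.ofReal_toReal hfin
  obtain ⟨hak, hw1, hw2⟩ := hC a N hN0 (Ψ.approxError_mul_le_toReal hfin)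
  have hdef := Ψ.holderNorm_of_mem hak
  have hlen : ∀ {m : ℕ} {α : Fin d → ℕ},
      α ∈ Finset.piAntidiag (Finset.univ : Finset (Fin d)) m → (multiWord α).length = m :=
    fun h => (length_multiWord _).trans (Finset.mem_piAntidiag.1 h).1
  have h1 : Ψ.smoothNorm k a ≤ c₁ * N := by
    rw [smoothNorm, hc₁, Finset.sum_mul]
    refine Finset.sum_le_sum fun m hm => ?_
    rw [Finset.sum_mul]
    refine Finset.sum_le_sum fun α hα => ?_
    rw [mul_assoc, multiGen_eq_iterGen]
    gcongr
    refine hw1 _ ?_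
    rw [hlen hα]
    exact Nat.lt_succ_iff.1 (Finset.mem_range.1 hm)
  have h2 : ∑ α ∈ Finset.piAntidiag (Finset.univ : Finset (Fin d)) k,
      Ψ.zygmundSeminorm (r - k) (Ψ.multiGen α a) ≤ ENNReal.ofReal (c₂ * N) := by
    rw [hc₂, Finset.sum_mul, ENNReal.ofReal_sum_of_nonneg fun _ _ => mul_nonneg (hC0 _) hN0]
    refine Finset.sum_le_sum fun α hα => ?_
    rw [multiGen_eq_iterGen]
    exact Ψ.zygmundSeminorm_le_ofReal (hw2 _ (hlen hα))
  calc Ψ.holderNorm r a ≤ ENNReal.ofReal (c₁ * N) + ENNReal.ofReal (c₂ * N) := by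
        rw [hdef]
        exact add_le_add (ENNReal.ofReal_le_ofReal h1) h2
    _ = ENNReal.ofReal ((c₁ + c₂) * N) := by
        rw [← ENNReal.ofReal_add (by positivity) (by positivity), add_mul]
    _ ≤ ENNReal.ofReal ((1 + c₁ + c₂) * N) := by
        refine ENNReal.ofReal_le_ofReal ?_
        gcongr
        linarith
    _ = _ := by
        rw [ENNReal.ofReal_mul (by positivity), hNof]
        rfl

end

end AutomorphismGroup

end

theorem mainTheorem3 {d : ℕ} {A : Type*} [NormedRing A] [NormedAlgebra ℂ A] [CompleteSpace A]
    (Ψ : AutomorphismGroup d A) (r : ℝ) (hr : 0 < r) :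
    Ψ.holderSpace r = Ψ.approxSpace r ∧
    (∃ C : ℝ≥0, ∀ a : A, Ψ.approxNorm r a ≤ C * Ψ.holderNorm r a ∧
      Ψ.holderNorm r a ≤ C * Ψ.approxNorm r a) ∧
    ∀ a : A, a ∈ Ψ.holderSpace r ↔
      ∃ C : ℝ, ∀ σ : ℝ≥0, 0 < σ → Ψ.approxError σ a ≤ C * (σ : ℝ) ^ (-r) := by
  obtain ⟨C₁, h₁⟩ := Ψ.exists_approxNorm_le hr
  obtain ⟨C₂, h₂⟩ := Ψ.exists_holderNorm_le hr
  have hiff : ∀ a, Ψ.holderNorm r a < ∞ ↔ Ψ.approxNorm r a < ∞ := fun a =>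
    ⟨fun h => (h₁ a).trans_lt (ENNReal.mul_lt_top ENNReal.coe_lt_top h),
      fun h => (h₂ a).trans_lt (ENNReal.mul_lt_top ENNReal.coe_lt_top h)⟩
  refine ⟨Set.ext hiff, ⟨max C₁ C₂, fun a => ⟨(h₁ a).trans ?_, (h₂ a).trans ?_⟩⟩,
    fun a => (hiff a).trans (Ψ.approxNorm_lt_top_iff hr a)⟩
  · gcongr
    exact le_max_left _ _
  · gcongr
    exact le_max_right _ _
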